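/- Let $k\ge 1$ and $n>2k$ be integers and let $\Omega\subset\mathbb R^n$ be a bounded open set. For $\lambda\in\mathbb R^n$ let $\sigma_i(\lambda)$ be the $i$-th elementary symmetric function, and $\Gamma_k=\{\lambda\in\mathbb R^n:\sigma_i(\lambda)\ge 0 \text{ for } 1\le i\le k\}$. For a $C^2$ function $u$ put $$A_{ij}(u)=u\,u_{ij}-\tfrac12|\nabla u|^2\delta_{ij},\qquad S_k(u)=\sigma_k(\lambda(A(u))),$$ where $\lambda(A(u))$ denotes the eigenvalues of the symmetric matrix $A(u)$. Let $$\tilde\Phi^k(\Omega)=\{u\in C^2(\Omega): u>0 \text{ and } \lambda(A(u))\in\Gamma_k \text{ in } \Omega\},$$ and let $\Phi^k(\Omega)$ be the set of functions $u\in L^1_{loc}(\Omega)$ with $u>0$ in $\Omega$ for which there is a sequence $u^{(m)}\in\tilde\Phi^k(\Omega)$ converging to $u$ in $L^1_{loc}(\Omega)$. Let $C^2(\bar\Omega)$ be the set of functions that are continuous on $\bar\Omega$ and $C^2$ in $\Omega$, with first and second derivatives that extend continuously to $\bar\Omega$. Suppose that $u,v\in C^2(\bar\Omega)\cap\Phi^k(\Omega)$,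 that $v>0$ on $\partial\Omega$ (as is the case when $u>0$ on $\partial\Omega$), and that $$v^{-n}S_k(v)\le u^{-n}S_k(u)\ \text{ in }\Omega,\qquad v\ge u\ \text{ on }\partial\Omega.$$ Then $u\le v$ in $\Omega$. -/

import Mathlib

open MeasureTheory Filter Topology

noncomputable section

namespace SigmaYamabe

/-- Partial derivative `u_i` at `x`. -/
def partialDeriv {n : ℕ} (u : EuclideanSpace ℝ (Fin n) → ℝ) (x : EuclideanSpace ℝ (Fin n))
    (i : Fin n) : ℝ :=
  fderiv ℝ u x (EuclideanSpace.single i 1)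

/-- The Hessian matrix `(u_{ij})` at `x`. -/
def hessian {n : ℕ} (u : EuclideanSpace ℝ (Fin n) → ℝ) (x : EuclideanSpace ℝ (Fin n)) :
    Matrix (Fin n) (Fin n) ℝ :=
  Matrix.of fun i j => partialDeriv (fun y => partialDeriv u y i) x j

/-- The matrix `A_{ij}(u) = u u_{ij} - |∇u|² δ_{ij} / 2` at `x`. -/
def schouten {n : ℕ} (u : EuclideanSpace ℝ (Fin n) → ℝ) (x : EuclideanSpace ℝ (Fin n)) :
    Matrix (Fin n) (Fin n) ℝ :=
  u x • hessian u x - ((1 / 2 : ℝ) * ∑ i, partialDeriv u x i ^ 2) • (1 : Matrix (Fin n) (Fin n) ℝ)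

/-- The real eigenvalues of a real square matrix, listed with their algebraic multiplicities.
For a symmetric matrix these are all `n` eigenvalues. -/
def eigenvalues {n : ℕ} (A : Matrix (Fin n) (Fin n) ℝ) : Multiset ℝ :=
  A.charpoly.roots

/-- `S_k(u) = σ_k(λ(A(u)))` at `x`, where `σ_k` is the `k`-th elementary symmetric function
(`Multiset.esymm`). -/
def S {n : ℕ} (k : ℕ) (u : EuclideanSpace ℝ (Fin n) → ℝ) (x : EuclideanSpace ℝ (Fin n)) : ℝ :=
  (eigenvalues (schouten u x)).esymm k

/-- The (closed) Gårding cone `Γ_k = {λ : σ_i(λ) ≥ 0 for 1 ≤ i ≤ k}`; since membership does not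
depend on the order of the entries, `λ` is recorded as a multiset. -/
def gardingCone (k : ℕ) : Set (Multiset ℝ) :=
  {l | ∀ i, 1 ≤ i → i ≤ k → 0 ≤ l.esymm i}

/-- The class of positive `u ∈ C²(Ω)` with `λ(A(u)) ∈ Γ_k` everywhere in `Ω`. -/
def PhiTilde {n : ℕ} (k : ℕ) (Ω : Set (EuclideanSpace ℝ (Fin n))) :
    Set (EuclideanSpace ℝ (Fin n) → ℝ) :=
  {u | ContDiffOn ℝ 2 u Ω ∧ (∀ x ∈ Ω, 0 < u x) ∧
    ∀ x ∈ Ω, eigenvalues (schouten u x) ∈ gardingCone k}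

/-- The class of positive `u ∈ L¹_loc(Ω)` that are limits in `L¹_loc(Ω)` of a sequence of
functions of the class `PhiTilde k Ω`. -/
def Phi {n : ℕ} (k : ℕ) (Ω : Set (EuclideanSpace ℝ (Fin n))) :
    Set (EuclideanSpace ℝ (Fin n) → ℝ) :=
  {u | LocallyIntegrableOn u Ω ∧ (∀ x ∈ Ω, 0 < u x) ∧
    ∃ U : ℕ → EuclideanSpace ℝ (Fin n) → ℝ, (∀ m, U m ∈ PhiTilde k Ω) ∧
      ∀ K : Set (EuclideanSpace ℝ (Fin n)), IsCompact K → K ⊆ Ω →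
        Tendsto (fun m => ∫⁻ x in K, ‖U m x - u x‖ₑ) atTop (𝓝 0)}

/-- `C²(Ω̄)` for an open set `Ω`: `u` is continuous on `Ω̄`, of class `C²` in `Ω`, and its
derivatives of orders one and two extend continuously from `Ω` to `Ω̄`. -/
def IsC2Closure {n : ℕ} (Ω : Set (EuclideanSpace ℝ (Fin n)))
    (u : EuclideanSpace ℝ (Fin n) → ℝ) : Prop :=
  ContinuousOn u (closure Ω) ∧ ContDiffOn ℝ 2 u Ω ∧
    (∀ i, ∃ g : EuclideanSpace ℝ (Fin n) → ℝ, ContinuousOn g (closure Ω) ∧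
      ∀ x ∈ Ω, g x = partialDeriv u x i) ∧
    ∀ i j, ∃ g : EuclideanSpace ℝ (Fin n) → ℝ, ContinuousOn g (closure Ω) ∧
      ∀ x ∈ Ω, g x = hessian u x i j

end SigmaYamabe

end

/-!
The operator `S_k` is homogeneous of degree `2k`, so `u ^ (-n) S_k(u)` has negative degree `2k - n`
and the comparison principle is a touching argument. If `u > v` somewhere, put `h = |x|² / 2 + 1` and
let `M > 1` be the maximum of `(u + ε h) / v` over the closure of `Ω`; for small `ε` it is attained
inside. There `M v` touches `u + ε h` from above, so `M² A(v) ≥ A(u + ε h)` as symmetric matrices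
(`schouten_of_touching`). The perturbation is chosen so that `A(u + ε h)` is `τ A(u)`, with
`τ = 1 + ε h / u`, plus a positive multiple of the identity (`schouten_add_paraboloid_zero`), which
makes the resulting inequality `M ^ (2k) S_k(v) > τ ^ k S_k(u)` strict even where `S_k(u) = 0`
(`S_lt_of_touching`). Since `M v = τ u` at this point and `τ ^ n < M` for small `ε`, this
contradicts the hypothesis on `u ^ (-n) S_k(u)` and `v ^ (-n) S_k(v)`.

The monotonicity of `σ_k` in the matrix order on the closed cone `Γ_k`
(`gardingCone_add_posSemidef`) is reduced by a rank-one update formula to the statement that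
deleting an entry maps `Γ_k` into `Γ_{k-1}`, which follows from Newton's inequality.

The argument needs `λ(A(u)) ∈ Γ_k` pointwise, whereas `u` is only an `L¹_loc` limit of functions
`U m` with this property (`schouten_mem_gardingCone_of_mem_Phi`). As `k ≥ 1`, the `U m` are
subharmonic, and the mean value inequality turns `L¹` convergence into a locally uniform upper bound.
Hence for `δ > 0` a multiple of `u + δ |x - x₀|² / 2` touches some `U m` from above near `x₀` and
inherits the cone condition there; letting the point tend to `x₀` and then `δ` to `0` gives the
condition for `u` at `x₀`, because the cone is closed.
-/

open MeasureTheory Filter Topology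

noncomputable section

namespace SigmaYamabe

/-! ### Newton's inequality and deletion of entries in the Gårding cone -/

section

open Polynomial

/-- By Rolle's theorem the derivative of a real-rooted polynomial is real-rooted. -/
theorem splits_derivative {p : ℝ[X]} (hp : p.Splits) : (derivative p).Splits := by
  rw [splits_iff_card_roots] at hp ⊢
  have h1 := card_roots_le_derivative p
  have h2 := card_roots' (derivative p)
  have h3 := natDegree_derivative_le p
  rcases Nat.eq_zero_or_pos p.natDegree with h | h
  · have : (derivative p).natDegree = 0 := by omega
    omega
  · omega

theorem splits_iterate_derivative {p : ℝ[X]} (hp : p.Splits) (m : ℕ) :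
    (derivative^[m] p).Splits := by
  induction m with
  | zero => exact hp
  | succ m ih => rw [Function.iterate_succ_apply']; exact splits_derivative ih

/-- Laguerre's inequality `p'² - p p'' ≥ 0` for a real-rooted polynomial `p`: for `p = (X - a) q`
the left side is `q² + (x - a)² (q'² - q q'')`. -/
theorem laguerre_nonneg {p : ℝ[X]} (hp : p.Splits) (x : ℝ) :
    0 ≤ (derivative p).eval x ^ 2 - p.eval x * (derivative (derivative p)).eval x := by
  have key : ∀ (c : ℝ) (s : Multiset ℝ), 0 ≤ (derivative (C c * (s.map fun a => X - C a).prod)).eval x ^ 2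
      - (C c * (s.map fun a => X - C a).prod).eval x
        * (derivative (derivative (C c * (s.map fun a => X - C a).prod))).eval x := by
    intro c s
    induction s using Multiset.induction_on with
    | empty => simp
    | cons a s ih =>
      set q := C c * (s.map fun a => X - C a).prod with hq
      have : C c * ((a ::ₘ s).map fun a => X - C a).prod = (X - C a) * q := by
        rw [Multiset.map_cons, Multiset.prod_cons, hq]; ring
      rw [this]
      simp only [derivative_mul, derivative_sub, derivative_X, derivative_C, derivative_add,
        eval_add, eval_mul, eval_sub, eval_X, eval_C, sub_zero, one_mul]
      nlinarith [sq_nonneg (eval x q), mul_nonneg (sq_nonneg (x - a)) ih]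
  rw [hp.eq_prod_roots]
  exact key _ _

theorem esymm_cons (a : ℝ) (s : Multiset ℝ) (j : ℕ) :
    (a ::ₘ s).esymm (j + 1) = s.esymm (j + 1) + a * s.esymm j := by
  simp [Multiset.esymm, Multiset.powersetCard_cons, Multiset.map_map,
    Multiset.sum_map_mul_left]

theorem esymm_zero_eq_one (s : Multiset ℝ) : s.esymm 0 = 1 := by
  simp [Multiset.esymm]

theorem esymm_eq_zero_of_card_lt {s : Multiset ℝ} {j : ℕ} (h : s.card < j) : s.esymm j = 0 := by
  simp [Multiset.esymm, Multiset.powersetCard_eq_empty j h]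

/-- Newton's inequality for elementary symmetric functions of reals of arbitrary signs, without the
sharp constant but strict. It is Laguerre's inequality at `0` for the derivative of order
`s.card - (j + 2)` of `∏ (X + r)`, whose three lowest coefficients are multiples of
`σ_{j+2}, σ_{j+1}, σ_j`. -/
theorem esymm_mul_esymm_lt_sq (s : Multiset ℝ) (j : ℕ)
    (h : 0 < s.esymm j * s.esymm (j + 2)) :
    s.esymm j * s.esymm (j + 2) < s.esymm (j + 1) ^ 2 := by
  have hj : j + 2 ≤ s.card := by
    by_contra hc
    rw [esymm_eq_zero_of_card_lt (not_le.1 hc)] at h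
    simp at h
  obtain ⟨m, hm⟩ := Nat.exists_eq_add_of_le hj
  set p : ℝ[X] := (s.map fun r => X + C r).prod with hp
  have hsp : p.Splits := by
    rw [hp]
    refine Splits.multisetProd ?_
    intro f hf
    obtain ⟨r, -, rfl⟩ := Multiset.mem_map.1 hf
    exact Splits.X_add_C r
  have hL := laguerre_nonneg (splits_iterate_derivative hsp m) 0
  rw [← Function.iterate_succ_apply' derivative, ← Function.iterate_succ_apply' derivative] at hL
  have e : ∀ i, i ≤ s.card → (derivative^[i] p).eval 0 =
      (i.factorial : ℝ) * s.esymm (s.card - i) := by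
    intro i hi
    rw [← coeff_zero_eq_eval_zero, coeff_iterate_derivative, zero_add, Nat.descFactorial_self,
      hp, Multiset.prod_X_add_C_coeff s hi, nsmul_eq_mul]
  rw [e _ (by omega), e _ (by omega), e _ (by omega)] at hL
  rw [show s.card - m = j + 2 by omega, show s.card - (m+1) = j + 1 by omega,
    show s.card - (m+2) = j by omega] at hL
  rw [Nat.factorial_succ (m+1), Nat.factorial_succ m] at hL
  push_cast at hL
  have hf : (0:ℝ) < m.factorial := by positivity
  have : 0 ≤ ((m.factorial:ℝ)^2 * (m+1)) *
      ((m+1) * s.esymm (j+1)^2 - (m+2) * (s.esymm j * s.esymm (j+2))) := by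
    nlinarith
  have h2 := nonneg_of_mul_nonneg_right this (by positivity)
  have hm0 : (0:ℝ) ≤ m := by positivity
  nlinarith

/-- Deleting an entry from an element of `Γ_{k+1}` leaves an element of `Γ_k`; so
`σ_1, …, σ_{k+1}` do not decrease when an entry of an element of `Γ_{k+1}` is increased. -/
theorem gardingCone_of_cons {a : ℝ} {s : Multiset ℝ} {k : ℕ}
    (h : a ::ₘ s ∈ gardingCone (k + 1)) : s ∈ gardingCone k := by
  have key : ∀ j, j ≤ k → 0 ≤ s.esymm j := by
    intro j
    induction j with
    | zero => intro _; rw [esymm_zero_eq_one]; norm_num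
    | succ j ih =>
      intro hj
      have ih := ih (by omega)
      by_contra hneg
      push Not at hneg
      have h1 := h (j + 1) (by omega) (by omega)
      have h2 := h (j + 2) (by omega) (by omega)
      rw [esymm_cons] at h1 h2
      have h3 : 0 < a * s.esymm j := by linarith
      have ha : 0 < a := pos_of_mul_pos_left h3 ih
      have h4 : 0 < s.esymm j := pos_of_mul_pos_right h3 ha.le
      have h5 : 0 < s.esymm (j + 2) := by
        nlinarith [mul_pos ha (neg_pos.2 hneg)]
      -- The signs force `σ_{j+1} + a σ_j ≥ 0` and `σ_{j+2} + a σ_{j+1} ≥ 0` to combine into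
      -- `σ_{j+1}² ≤ σ_j σ_{j+2}`, against Newton's inequality.
      have := esymm_mul_esymm_lt_sq s j (mul_pos h4 h5)
      nlinarith [mul_le_mul_of_nonneg_left h2 h4.le,
        mul_nonneg_of_nonpos_of_nonpos hneg.le hneg.le, mul_nonneg h1 (neg_pos.2 hneg).le]
  exact fun i _ hi => key i hi

end

variable {n : ℕ}

/-! ### Monotonicity of `σ_k` in the matrix order -/

section

open Polynomial Matrix

theorem eigenvalues_eq_map {A : Matrix (Fin n) (Fin n) ℝ} (hA : A.IsHermitian) :
    eigenvalues A = Finset.univ.val.map hA.eigenvalues := by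
  rw [eigenvalues, hA.roots_charpoly_eq_eigenvalues]; rfl

theorem exists_orthogonal_diagonalization {A : Matrix (Fin n) (Fin n) ℝ} (hA : A.IsHermitian) :
    ∃ U : Matrix (Fin n) (Fin n) ℝ, U * star U = 1 ∧ star U * U = 1 ∧
      A = U * diagonal hA.eigenvalues * star U :=
  ⟨hA.eigenvectorUnitary, (Unitary.mem_iff.1 hA.eigenvectorUnitary.2).2,
    (Unitary.mem_iff.1 hA.eigenvectorUnitary.2).1, by
      have := hA.spectral_theorem
      rwa [Unitary.conjStarAlgAut_apply] at this⟩

theorem esymm_eigenvalues {A : Matrix (Fin n) (Fin n) ℝ} (hA : A.IsHermitian) {j : ℕ}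
    (hj : j ≤ n) : (eigenvalues A).esymm j = (-1) ^ j * A.charpoly.coeff (n - j) := by
  have hc : (eigenvalues A).card = n := by rw [eigenvalues_eq_map hA]; simp
  have h : A.charpoly = ((eigenvalues A).map fun a => X - C a).prod := by
    have := hA.splits_charpoly.eq_prod_roots
    rwa [(charpoly_monic A).leadingCoeff, C_1, one_mul] at this
  rw [h, Multiset.prod_X_sub_C_coeff _ (by omega), hc, show n - (n - j) = j by omega, ← mul_assoc,
    ← mul_pow]
  simp

theorem continuous_charpoly_coeff (i : ℕ) :
    Continuous fun A : Matrix (Fin n) (Fin n) ℝ => A.charpoly.coeff i := by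
  have : (fun A : Matrix (Fin n) (Fin n) ℝ => A.charpoly.coeff i) =
      fun A => MvPolynomial.eval (fun p : Fin n × Fin n => A p.1 p.2)
        ((charpoly.univ ℝ (Fin n)).coeff i) := by
    funext A
    have := charpoly.univ_coeff_eval₂Hom (n := Fin n) (RingHom.id ℝ)
      (fun p : Fin n × Fin n => A p.1 p.2) i
    rw [MvPolynomial.eval, this]; rfl
  rw [this]
  have := MvPolynomial.continuous_eval ((charpoly.univ ℝ (Fin n)).coeff i)
  exact this.comp (by fun_prop)

theorem isClosed_hermitian_gardingCone {k : ℕ} (hk : k ≤ n) :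
    IsClosed {A : Matrix (Fin n) (Fin n) ℝ | A.IsHermitian ∧ eigenvalues A ∈ gardingCone k} := by
  have : {A : Matrix (Fin n) (Fin n) ℝ | A.IsHermitian ∧ eigenvalues A ∈ gardingCone k} =
      {A | Aᴴ = A} ∩ ⋂ j ∈ Finset.Icc 1 k, {A | 0 ≤ (-1) ^ j * A.charpoly.coeff (n - j)} := by
    ext A
    simp only [Set.mem_ofPred_eq, Set.mem_inter_iff, Set.mem_iInter, gardingCone, Finset.mem_Icc]
    constructor
    · rintro ⟨h, h'⟩
      exact ⟨h, fun j hj => by rw [← esymm_eigenvalues h (by omega)]; exact h' j hj.1 hj.2⟩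
    · rintro ⟨h, h'⟩
      exact ⟨h, fun j h1 h2 => by
        rw [esymm_eigenvalues h (by omega)]; exact h' j ⟨h1, h2⟩⟩
  rw [this]
  refine IsClosed.inter (isClosed_eq (by fun_prop) continuous_id) ?_
  refine isClosed_biInter fun j _ => isClosed_le continuous_const ?_
  exact continuous_const.mul (continuous_charpoly_coeff _)

/-- The characteristic polynomial of a rank-one perturbation of a diagonal matrix. -/
theorem charpoly_diagonal_add_vecMulVec (d w : Fin n → ℝ) :
    (diagonal d + vecMulVec w w).charpoly =
      ∏ i, (X - C (d i)) - ∑ i, C (w i ^ 2) * ∏ l ∈ Finset.univ.erase i, (X - C (d l)) := by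
  -- Away from the diagonal entries this is the matrix determinant lemma.
  refine Polynomial.eq_of_infinite_eval_eq _ _ ?_
  refine Set.Infinite.mono (s := (Set.range d)ᶜ) ?_ (Set.finite_range d).infinite_compl
  intro t ht
  have ht' : ∀ i, t - d i ≠ 0 := fun i h => ht ⟨i, by linarith⟩
  simp only [Set.mem_ofPred_eq, eval_charpoly, eval_sub, eval_prod, eval_X, eval_C, eval_finsetSum,
    eval_mul]
  have e : (scalar (Fin n)) t - (diagonal d + vecMulVec w w) =
      diagonal (fun i => t - d i) + replicateCol Unit (-w) * replicateRow Unit w := by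
    rw [← vecMulVec_eq, neg_vecMulVec, scalar_apply, ← diagonal_sub]; abel
  rw [e, det_add_replicateCol_mul_replicateRow]
  · have hinv : (diagonal fun i => t - d i)⁻¹ = diagonal fun i => (t - d i)⁻¹ :=
      inv_eq_right_inv (by simp [ht'])
    have hs : (1 + replicateRow Unit w * diagonal (fun i => (t - d i)⁻¹) *
        replicateCol Unit (-w)).det = 1 - ∑ i, w i ^ 2 / (t - d i) := by
      rw [det_unique, Matrix.add_apply, one_apply_eq, mul_apply, sub_eq_add_neg,
        ← Finset.sum_neg_distrib]
      congr 1
      refine Finset.sum_congr rfl fun i _ => ?_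
      rw [mul_diagonal, replicateRow_apply, replicateCol_apply, Pi.neg_apply]
      ring
    rw [det_diagonal, hinv]
    rw [hs, mul_sub, mul_one, Finset.mul_sum]
    congr 1
    refine Finset.sum_congr rfl fun i _ => ?_
    rw [← Finset.mul_prod_erase _ _ (Finset.mem_univ i)]
    field_simp [ht' i]
  · rw [det_diagonal]
    exact (Finset.prod_ne_zero_iff.2 fun i _ => ht' i).isUnit

/-- A rank-one perturbation `v vᵀ` of a symmetric matrix with eigenvalues `λ` changes `σ_{j+1}` by a
combination, with nonnegative coefficients, of the `σ_j` of `λ` with one entry deleted. Here `w` is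
`v` in an orthonormal eigenbasis. -/
theorem esymm_eigenvalues_add_vecMulVec {A : Matrix (Fin n) (Fin n) ℝ} (hA : A.IsHermitian)
    (v : Fin n → ℝ) : ∃ w : Fin n → ℝ, ∀ j, j + 1 ≤ n →
      (eigenvalues (A + vecMulVec v v)).esymm (j + 1) = (eigenvalues A).esymm (j + 1) +
        ∑ i, w i ^ 2 * ((Finset.univ.erase i).val.map hA.eigenvalues).esymm j := by
  obtain ⟨U, hUU, hUU', hAd⟩ := exists_orthogonal_diagonalization hA
  set w := star U *ᵥ v with hw
  have hB : (A + vecMulVec v v).IsHermitian := by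
    refine hA.add ?_
    have := (posSemidef_vecMulVec_self_star v).1
    simpa using this
  have hvw : vecMulVec v v = U * vecMulVec w w * star U := by
    rw [mul_vecMulVec, vecMulVec_mul, hw, mulVec_mulVec, hUU, one_mulVec]
    congr 1
    have : star U *ᵥ v = v ᵥ* U := by
      rw [star_eq_conjTranspose, conjTranspose_eq_transpose_of_trivial, mulVec_transpose]
    rw [this, vecMul_vecMul, hUU, vecMul_one]
  have hcp : (A + vecMulVec v v).charpoly =
      (diagonal hA.eigenvalues + vecMulVec w w).charpoly := by
    conv_lhs => rw [hAd, hvw, ← add_mul, ← mul_add, charpoly_mul_comm, ← mul_assoc, hUU', one_mul]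
  refine ⟨w, fun j hj => ?_⟩
  rw [esymm_eigenvalues hB hj, hcp, charpoly_diagonal_add_vecMulVec]
  have hp : ∏ i, (X - C (hA.eigenvalues i)) = A.charpoly := by
    rw [hA.charpoly_eq]; rfl
  rw [hp, coeff_sub, mul_sub, ← esymm_eigenvalues hA hj, sub_eq_add_neg, finsetSum_coeff,
    Finset.mul_sum, ← Finset.sum_neg_distrib]
  congr 1
  refine Finset.sum_congr rfl fun i _ => ?_
  have hcard : ((Finset.univ.erase i).val.map hA.eigenvalues).card = n - 1 := by simp
  have h1 : (∏ l ∈ Finset.univ.erase i, (X - C (hA.eigenvalues l))) =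
      (((Finset.univ.erase i).val.map hA.eigenvalues).map fun a => X - C a).prod := by
    rw [Multiset.map_map]; rfl
  rw [coeff_C_mul, h1, Multiset.prod_X_sub_C_coeff _ (by omega), hcard,
    show n - 1 - (n - (j + 1)) = j by omega, pow_succ]
  have : ((-1 : ℝ) ^ j) * (-1) ^ j = 1 := by rw [← mul_pow]; simp
  linear_combination (w i ^ 2 * ((Finset.univ.erase i).val.map hA.eigenvalues).esymm j) * this

theorem gardingCone_add_vecMulVec {A : Matrix (Fin n) (Fin n) ℝ} (hA : A.IsHermitian)
    (v : Fin n → ℝ) {k : ℕ} (hk : k ≤ n) (hG : eigenvalues A ∈ gardingCone k) :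
    eigenvalues (A + vecMulVec v v) ∈ gardingCone k ∧
      ∀ j ≤ k, (eigenvalues A).esymm j ≤ (eigenvalues (A + vecMulVec v v)).esymm j := by
  have key : ∀ j ≤ k, (eigenvalues A).esymm j ≤ (eigenvalues (A + vecMulVec v v)).esymm j := by
    intro j hj
    rcases j with _ | j
    · simp [esymm_zero_eq_one]
    obtain ⟨w, hw⟩ := esymm_eigenvalues_add_vecMulVec hA v
    rw [hw j (by omega), le_add_iff_nonneg_right]
    refine Finset.sum_nonneg fun i _ => mul_nonneg (sq_nonneg _) ?_
    obtain ⟨k, rfl⟩ : ∃ k', k = k' + 1 := ⟨k - 1, by omega⟩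
    have h1 : hA.eigenvalues i ::ₘ (Finset.univ.erase i).val.map hA.eigenvalues
        ∈ gardingCone (k + 1) := by
      rw [← Multiset.map_cons, Finset.erase_val, Multiset.cons_erase (Finset.mem_univ_val i),
        ← eigenvalues_eq_map hA]
      exact hG
    rcases j with _ | j
    · simp [esymm_zero_eq_one]
    · exact gardingCone_of_cons h1 _ (by omega) (by omega)
  exact ⟨fun j h1 h2 => (hG j h1 h2).trans (key j h2), key⟩

/-- Membership in `Γ_k` is preserved, and `σ_0, …, σ_k` do not decrease, when a positive semidefinite
matrix is added: such a matrix is a sum of rank-one matrices `v vᵀ`. -/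
theorem gardingCone_add_posSemidef {A P : Matrix (Fin n) (Fin n) ℝ} (hA : A.IsHermitian)
    (hP : P.PosSemidef) {k : ℕ} (hk : k ≤ n) (hG : eigenvalues A ∈ gardingCone k) :
    eigenvalues (A + P) ∈ gardingCone k ∧
      ∀ j ≤ k, (eigenvalues A).esymm j ≤ (eigenvalues (A + P)).esymm j := by
  obtain ⟨m, v, rfl⟩ := posSemidef_iff_eq_sum_vecMulVec.1 hP
  clear hP
  induction m with
  | zero => simpa using hG
  | succ m ih =>
    obtain ⟨h1, h2⟩ := ih (fun i => v i.castSucc)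
    rw [Fin.sum_univ_castSucc, ← add_assoc]
    have hH : (A + ∑ i : Fin m, vecMulVec (v i.castSucc) (star (v i.castSucc))).IsHermitian :=
      hA.add (posSemidef_sum _ fun i _ => posSemidef_vecMulVec_self_star _).1
    have h3 := gardingCone_add_vecMulVec hH (v (Fin.last m)) hk h1
    exact ⟨h3.1, fun j hj => (h2 j hj).trans (h3.2 j hj)⟩

theorem eigenvalues_smul_add {A : Matrix (Fin n) (Fin n) ℝ} (hA : A.IsHermitian) (a b : ℝ) :
    eigenvalues (a • A + b • 1) = (eigenvalues A).map (fun t => a * t + b) := by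
  obtain ⟨U, hUU, hUU', hAd⟩ := exists_orthogonal_diagonalization hA
  have h : a • A + b • 1 = U * diagonal (fun i => a * hA.eigenvalues i + b) * star U := by
    have : diagonal (fun i => a * hA.eigenvalues i + b) = a • diagonal hA.eigenvalues
        + b • (1 : Matrix (Fin n) (Fin n) ℝ) := by
      ext i j
      by_cases hij : i = j <;> simp [diagonal, hij, one_apply]
    rw [this, mul_add, add_mul, mul_smul_comm, smul_mul_assoc, ← hAd, mul_smul_comm, smul_mul_assoc,
      mul_one, hUU]
  have hc : (a • A + b • 1).charpoly = ∏ i, (X - C (a * hA.eigenvalues i + b)) := by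
    rw [h, charpoly_mul_comm, ← mul_assoc, hUU', one_mul, charpoly_diagonal]
  rw [eigenvalues, hc, roots_prod _ _ (Finset.prod_ne_zero_iff.2 fun i _ => X_sub_C_ne_zero _),
    eigenvalues_eq_map hA]
  simp only [roots_X_sub_C, Multiset.bind_singleton, Multiset.map_map, Function.comp_def]

theorem esymm_smul (c : ℝ) (s : Multiset ℝ) (j : ℕ) :
    (s.map (fun t => c * t)).esymm j = c ^ j * s.esymm j :=
  (Multiset.pow_smul_esymm c j s).symm

theorem eigenvalues_smul {A : Matrix (Fin n) (Fin n) ℝ} (hA : A.IsHermitian) (a : ℝ) :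
    eigenvalues (a • A) = (eigenvalues A).map (fun t => a * t) := by
  simpa using eigenvalues_smul_add hA a 0

theorem gardingCone_smul {s : Multiset ℝ} {k : ℕ} {c : ℝ} (hc : 0 ≤ c) (h : s ∈ gardingCone k) :
    s.map (fun t => c * t) ∈ gardingCone k := fun j h1 h2 => by
  rw [esymm_smul]; exact mul_nonneg (by positivity) (h j h1 h2)

theorem gardingCone_of_smul {s : Multiset ℝ} {k : ℕ} {c : ℝ} (hc : 0 < c)
    (h : s.map (fun t => c * t) ∈ gardingCone k) : s ∈ gardingCone k := fun j h1 h2 => by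
  have := h j h1 h2
  rw [esymm_smul] at this
  exact nonneg_of_mul_nonneg_right this (by positivity)

/-- The Taylor expansion of `∏ (X + r)` at `c`, read off coefficientwise. -/
theorem esymm_add_const (s : Multiset ℝ) (c : ℝ) {k : ℕ} (hk : k ≤ s.card) :
    (s.map (fun t => t + c)).esymm k =
      ∑ j ∈ Finset.range (k + 1), s.esymm j * ((s.card - j).choose (s.card - k) * c ^ (k - j)) := by
  have h1 : ((s.map (fun t => t + c)).map fun r => X + C r).prod =
      taylor c (s.map fun r => X + C r).prod := by
    rw [taylor_apply, multiset_prod_comp, Multiset.map_map, Multiset.map_map]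
    congr 2
    funext t
    simp; ring
  have h2 := Multiset.prod_X_add_C_coeff (s.map (fun t => t + c)) (k := s.card - k) (by simp)
  rw [Multiset.card_map, show s.card - (s.card - k) = k by omega] at h2
  rw [← h2, h1, Multiset.prod_X_add_C_eq_sum_esymm, map_sum, finsetSum_coeff]
  have h3 : ∀ j, (taylor c (C (s.esymm j) * X ^ (s.card - j))).coeff (s.card - k) =
      s.esymm j * ((s.card - j).choose (s.card - k) * c ^ (s.card - j - (s.card - k))) := by
    intro j
    rw [C_mul_X_pow_eq_monomial, taylor_coeff, hasseDeriv_monomial, eval_monomial]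
    ring
  simp_rw [h3]
  symm
  refine Finset.sum_subset_zero_on_sdiff (Finset.range_mono (by omega)) ?_ ?_
  · intro j hj
    simp only [Finset.mem_sdiff, Finset.mem_range] at hj
    rw [Nat.choose_eq_zero_of_lt (by omega)]
    simp
  · intro j hj
    rw [Finset.mem_range] at hj
    rw [show s.card - j - (s.card - k) = k - j by omega]

/-- Adding `c > 0` to all entries strictly increases `σ_k` on the closed cone `Γ_k`: the term `j = 0`
of `esymm_add_const` is a positive multiple of `c ^ k`. This is where strictness comes from when
`σ_k` degenerates. -/
theorem esymm_lt_esymm_add_const {s : Multiset ℝ} {c : ℝ} {k : ℕ} (hc : 0 < c) (hk1 : 1 ≤ k)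
    (hk : k ≤ s.card) (hs : s ∈ gardingCone k) :
    s.esymm k < (s.map (fun t => t + c)).esymm k := by
  rw [esymm_add_const s c hk, Finset.sum_range_succ]
  have : 0 < ∑ j ∈ Finset.range k, s.esymm j * ((s.card - j).choose (s.card - k) * c ^ (k - j)) := by
    refine Finset.sum_pos' ?_ ⟨0, Finset.mem_range.2 hk1, ?_⟩
    · intro j hj
      rw [Finset.mem_range] at hj
      refine mul_nonneg ?_ (by positivity)
      rcases j with _ | j
      · simp [esymm_zero_eq_one]
      · exact hs _ (by omega) (by omega)
    · rw [esymm_zero_eq_one]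
      have : 0 < (s.card - 0).choose (s.card - k) := Nat.choose_pos (by omega)
      positivity
  simpa using this

end

/-! ### The Hessian and the matrix `A(u)`: touching and perturbation -/

section

open Matrix

theorem hessian_apply {f : EuclideanSpace ℝ (Fin n) → ℝ} {x : EuclideanSpace ℝ (Fin n)}
    (hf : ContDiffAt ℝ 2 f x) (i j : Fin n) :
    hessian f x i j =
      fderiv ℝ (fderiv ℝ f) x (EuclideanSpace.single j 1) (EuclideanSpace.single i 1) := by
  have h1 : DifferentiableAt ℝ (fderiv ℝ f) x :=
    (hf.fderiv_right (m := 1) (by norm_num)).differentiableAt (by norm_num)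
  simp only [hessian, of_apply, partialDeriv]
  rw [fderiv_clm_apply h1 (differentiableAt_const _)]
  simp

theorem isHermitian_hessian {f : EuclideanSpace ℝ (Fin n) → ℝ} {x : EuclideanSpace ℝ (Fin n)}
    (hf : ContDiffAt ℝ 2 f x) : (hessian f x).IsHermitian := by
  ext i j
  rw [conjTranspose_apply, star_trivial, hessian_apply hf, hessian_apply hf]
  exact (hf.isSymmSndFDerivAt (by simp)) _ _

theorem isHermitian_schouten {f : EuclideanSpace ℝ (Fin n) → ℝ} {x : EuclideanSpace ℝ (Fin n)}
    (hf : ContDiffAt ℝ 2 f x) : (schouten f x).IsHermitian := by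
  unfold schouten
  refine IsHermitian.sub ?_ ?_
  · exact (isHermitian_hessian hf).smul (star_trivial _)
  · exact isHermitian_one.smul (star_trivial _)

theorem partialDeriv_linearComb {f g : EuclideanSpace ℝ (Fin n) → ℝ}
    {x : EuclideanSpace ℝ (Fin n)} (hf : DifferentiableAt ℝ f x) (hg : DifferentiableAt ℝ g x)
    (a b : ℝ) (i : Fin n) :
    partialDeriv (fun y => a * f y + b * g y) x i
      = a * partialDeriv f x i + b * partialDeriv g x i := by
  unfold partialDeriv
  rw [fderiv_fun_add (hf.const_mul a) (hg.const_mul b), fderiv_const_mul hf, fderiv_const_mul hg]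
  simp

theorem hessian_linearComb {f g : EuclideanSpace ℝ (Fin n) → ℝ}
    {x : EuclideanSpace ℝ (Fin n)} (hf : ContDiffAt ℝ 2 f x) (hg : ContDiffAt ℝ 2 g x)
    (a b : ℝ) :
    hessian (fun y => a * f y + b * g y) x = a • hessian f x + b • hessian g x := by
  ext i j
  have hd : ∀ {f : EuclideanSpace ℝ (Fin n) → ℝ}, ContDiffAt ℝ 2 f x →
      DifferentiableAt ℝ (fun y => partialDeriv f y i) x := fun hf =>
    ((hf.fderiv_right (m := 1) (by norm_num)).differentiableAt (by norm_num)).clm_apply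
      (differentiableAt_const _)
  have he : ∀ {f : EuclideanSpace ℝ (Fin n) → ℝ}, ContDiffAt ℝ 2 f x →
      ∀ᶠ y in 𝓝 x, DifferentiableAt ℝ f y := fun hf =>
    (hf.eventually (by simp)).mono fun y hy => hy.differentiableAt (by norm_num)
  have : (fun y => partialDeriv (fun y => a * f y + b * g y) y i) =ᶠ[𝓝 x]
      fun y => a * partialDeriv f y i + b * partialDeriv g y i := by
    filter_upwards [he hf, he hg] with y h1 h2
    exact partialDeriv_linearComb h1 h2 a b i
  simp only [hessian, of_apply, Matrix.add_apply, Matrix.smul_apply, smul_eq_mul]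
  rw [← partialDeriv_linearComb (hd hf) (hd hg), partialDeriv, this.fderiv_eq]
  rfl

theorem eq_sum_smul_single (y : EuclideanSpace ℝ (Fin n)) :
    y = ∑ i, y i • EuclideanSpace.single i (1 : ℝ) := by
  ext j
  simp [Finset.sum_apply, Pi.single_apply]

theorem dotProduct_hessian_mulVec {f : EuclideanSpace ℝ (Fin n) → ℝ}
    {x : EuclideanSpace ℝ (Fin n)} (hf : ContDiffAt ℝ 2 f x) (w : Fin n → ℝ) :
    w ⬝ᵥ (hessian f x *ᵥ w) = fderiv ℝ (fderiv ℝ f) x (WithLp.toLp 2 w) (WithLp.toLp 2 w) := by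
  have hw : WithLp.toLp 2 w = ∑ i, w i • EuclideanSpace.single i (1 : ℝ) :=
    eq_sum_smul_single (WithLp.toLp 2 w)
  rw [hw]
  simp only [map_sum, map_smul, _root_.sum_apply, _root_.smul_apply,
    smul_eq_mul, dotProduct, mulVec, hessian_apply hf, Finset.mul_sum]
  refine Finset.sum_congr rfl fun i _ => Finset.sum_congr rfl fun j _ => ?_
  rw [(hf.isSymmSndFDerivAt (by simp)) (EuclideanSpace.single j 1)]
  ring

/-- The second-order necessary condition at a local minimum. -/
theorem posSemidef_hessian_of_isLocalMin {f : EuclideanSpace ℝ (Fin n) → ℝ}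
    {x : EuclideanSpace ℝ (Fin n)} (hf : ContDiffAt ℝ 2 f x) (hmin : IsLocalMin f x) :
    (hessian f x).PosSemidef := by
  rw [posSemidef_iff_dotProduct_mulVec]
  refine ⟨isHermitian_hessian hf, fun w => ?_⟩
  rw [star_trivial, dotProduct_hessian_mulVec hf]
  set W : EuclideanSpace ℝ (Fin n) := WithLp.toLp 2 w
  by_contra! hneg
  set q := fderiv ℝ (fderiv ℝ f) x W W with hq
  set ℓ : ℝ → EuclideanSpace ℝ (Fin n) := fun t => x + t • W with hℓ
  have hℓd : ∀ t, HasDerivAt ℓ W t := fun t =>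
    (((hasDerivAt_id t).smul_const W).const_add x).congr_deriv (one_smul ℝ W)
  have hℓ0 : ℓ 0 = x := by simp [hℓ]
  have hℓc : Tendsto ℓ (𝓝 0) (𝓝 x) := by
    have := (hℓd 0).continuousAt.tendsto; rwa [hℓ0] at this
  -- Half of the negative second derivative along the line is subtracted from `-f`, so that the
  -- second derivative test still applies and yields a strict inequality.
  set F : ℝ → ℝ := fun t => -f (ℓ t) + q / 4 * t ^ 2 with hF
  have hd1 : ∀ᶠ t in 𝓝 (0 : ℝ), HasDerivAt F (-(fderiv ℝ f (ℓ t) W) + q / 2 * t) t := by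
    have : ∀ᶠ y in 𝓝 x, DifferentiableAt ℝ f y :=
      (hf.eventually (by simp)).mono fun y hy => hy.differentiableAt (by norm_num)
    filter_upwards [hℓc.eventually this] with t ht
    have h1 := ht.hasFDerivAt.comp_hasDerivAt t (hℓd t)
    have h2 := ((hasDerivAt_pow 2 t).const_mul (q / 4))
    refine (h1.neg.add h2).congr_deriv ?_
    simp; ring
  have hd2 : HasDerivAt (deriv F) (-q + q / 2) 0 := by
    have h1 : DifferentiableAt ℝ (fderiv ℝ f) (ℓ 0) := by
      rw [hℓ0]
      exact (hf.fderiv_right (m := 1) (by norm_num)).differentiableAt (by norm_num)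
    have h2 := h1.hasFDerivAt.comp_hasDerivAt 0 (hℓd 0)
    have h3 : HasDerivAt (fun t => fderiv ℝ f (ℓ t) W) q 0 := by
      have := h2.clm_apply (hasDerivAt_const (0 : ℝ) W)
      refine this.congr_deriv ?_
      simp [hq, hℓ0]
    have h4 : HasDerivAt (fun t => -(fderiv ℝ f (ℓ t) W) + q / 2 * t) (-q + q / 2) 0 := by
      exact (h3.neg.add ((hasDerivAt_id (0 : ℝ)).const_mul (q / 2))).congr_deriv (by simp)
    refine h4.congr_of_eventuallyEq ?_
    filter_upwards [hd1] with t ht using ht.deriv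
  have hfx : fderiv ℝ f x = 0 := hmin.fderiv_eq_zero
  have hlm : IsLocalMin F 0 := by
    refine isLocalMin_of_deriv_deriv_pos ?_ ?_ ?_
    · rw [hd2.deriv]; linarith
    · rw [hd1.self_of_nhds.deriv, hℓ0, hfx]; simp
    · exact hd1.self_of_nhds.continuousAt
  have h5 : ∀ᶠ t in 𝓝 (0 : ℝ), t = 0 := by
    filter_upwards [hlm, hℓc.eventually hmin] with t h6 h7
    simp only [hF, hℓ0] at h6
    by_contra ht
    have : 0 < t ^ 2 := by positivity
    nlinarith
  have h6 : ({0} : Set ℝ) ∈ 𝓝 (0 : ℝ) := h5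
  rw [mem_nhds_iff] at h6
  obtain ⟨t, ht, hto, h0⟩ := h6
  have : t = {0} := Set.Subset.antisymm ht (by simpa using h0)
  exact not_isOpen_singleton (0 : ℝ) (this ▸ hto)

/-- If `M g` touches `f ≥ 0` from above at `x`, then `A(f) ≤ A(M g) = M² A(g)` at `x` as symmetric
matrices. -/
theorem schouten_of_touching {f g : EuclideanSpace ℝ (Fin n) → ℝ}
    {x : EuclideanSpace ℝ (Fin n)} (hf : ContDiffAt ℝ 2 f x) (hg : ContDiffAt ℝ 2 g x) {M : ℝ}
    (hle : ∀ᶠ y in 𝓝 x, f y ≤ M * g y) (heq : f x = M * g x) (hpos : 0 ≤ f x) :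
    ∃ P : Matrix (Fin n) (Fin n) ℝ, P.PosSemidef ∧ M ^ 2 • schouten g x = schouten f x + P := by
  set φ : EuclideanSpace ℝ (Fin n) → ℝ := fun y => M * g y + (-1) * f y with hφ
  have hφc : ContDiffAt ℝ 2 φ x := (contDiffAt_const.mul hg).add (contDiffAt_const.mul hf)
  have hmin : IsLocalMin φ x := by
    filter_upwards [hle] with y hy
    simp only [hφ]; linarith
  have hP := posSemidef_hessian_of_isLocalMin hφc hmin
  refine ⟨f x • hessian φ x, hP.smul hpos, ?_⟩
  have hd : ∀ i, partialDeriv f x i = M * partialDeriv g x i := by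
    intro i
    have h1 := partialDeriv_linearComb (hg.differentiableAt (by norm_num))
      (hf.differentiableAt (by norm_num)) M (-1) i
    have h2 : partialDeriv φ x i = 0 := by simp [partialDeriv, hmin.fderiv_eq_zero]
    rw [← hφ, h2] at h1
    linarith
  rw [hφ, hessian_linearComb hg hf]
  simp only [schouten, hd, mul_pow, ← Finset.mul_sum, heq]
  ext i j
  simp only [Matrix.sub_apply, Matrix.add_apply, Matrix.smul_apply, smul_eq_mul]
  ring

theorem continuousAt_hessian {f : EuclideanSpace ℝ (Fin n) → ℝ}
    {x : EuclideanSpace ℝ (Fin n)} (hf : ContDiffAt ℝ 2 f x) : ContinuousAt (hessian f) x := by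
  have h1 : ContDiffAt ℝ 0 (fderiv ℝ (fderiv ℝ f)) x :=
    (hf.fderiv_right (m := 1) (by norm_num)).fderiv_right (by norm_num)
  refine continuousAt_pi.2 fun i => continuousAt_pi.2 fun j => ?_
  have h2 : ContinuousAt (fun y => fderiv ℝ (fderiv ℝ f) y (EuclideanSpace.single j 1)
      (EuclideanSpace.single i 1)) x :=
    (h1.continuousAt.clm_apply continuousAt_const).clm_apply continuousAt_const
  refine h2.congr ?_
  filter_upwards [hf.eventually (by simp)] with y hy
  rw [hessian_apply hy]

theorem continuousAt_schouten {f : EuclideanSpace ℝ (Fin n) → ℝ}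
    {x : EuclideanSpace ℝ (Fin n)} (hf : ContDiffAt ℝ 2 f x) : ContinuousAt (schouten f) x := by
  have h1 : ContDiffAt ℝ 1 (fderiv ℝ f) x := hf.fderiv_right (by norm_num)
  have h2 : ∀ i, ContinuousAt (fun y => partialDeriv f y i) x := fun i =>
    h1.continuousAt.clm_apply continuousAt_const
  have h3 : ContinuousAt (fun y => (1 / 2 : ℝ) * ∑ i, partialDeriv f y i ^ 2) x :=
    continuousAt_const.mul (tendsto_finsetSum _ fun i _ => (h2 i).pow 2)
  exact (hf.continuousAt.smul (continuousAt_hessian hf)).sub (h3.smul continuousAt_const)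

/-- The paraboloid `‖y - a‖² / 2 + c`, whose Hessian is the identity. -/
def paraboloid (a : EuclideanSpace ℝ (Fin n)) (c : ℝ) (y : EuclideanSpace ℝ (Fin n)) : ℝ :=
  ‖y - a‖ ^ 2 / 2 + c

theorem contDiff_paraboloid (a : EuclideanSpace ℝ (Fin n)) (c : ℝ) :
    ContDiff ℝ 2 (paraboloid a c) := by
  unfold paraboloid
  exact (((contDiff_id.sub contDiff_const).norm_sq ℝ).div_const 2).add contDiff_const

theorem partialDeriv_paraboloid (a : EuclideanSpace ℝ (Fin n)) (c : ℝ)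
    (y : EuclideanSpace ℝ (Fin n)) (i : Fin n) : partialDeriv (paraboloid a c) y i = y i - a i := by
  have h : HasFDerivAt (paraboloid a c) (innerSL ℝ (y - a)) y := by
    have h1 := (((hasFDerivAt_id y).sub_const a).norm_sq.mul_const (1 / 2 : ℝ)).add_const c
    refine (h1.congr_fderiv ?_).congr_of_eventuallyEq (.of_forall fun z => ?_)
    · ext z; simp
    · simp [paraboloid]; ring
  rw [partialDeriv, h.fderiv]
  simp [EuclideanSpace.inner_single_right]

theorem hessian_paraboloid (a : EuclideanSpace ℝ (Fin n)) (c : ℝ)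
    (y : EuclideanSpace ℝ (Fin n)) : hessian (paraboloid a c) y = 1 := by
  ext i j
  simp only [hessian, of_apply, partialDeriv_paraboloid]
  have : HasFDerivAt (fun y : EuclideanSpace ℝ (Fin n) => y i - a i)
      (EuclideanSpace.proj (𝕜 := ℝ) i) y :=
    (EuclideanSpace.proj (𝕜 := ℝ) i).hasFDerivAt.sub_const _
  rw [partialDeriv, this.fderiv]
  by_cases h : i = j <;> simp [h, one_apply]

theorem schouten_add_paraboloid {f : EuclideanSpace ℝ (Fin n) → ℝ}
    {x : EuclideanSpace ℝ (Fin n)} (hf : ContDiffAt ℝ 2 f x) (a : EuclideanSpace ℝ (Fin n))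
    (c ε : ℝ) :
    schouten (fun y => f y + ε * paraboloid a c y) x =
      (f x + ε * paraboloid a c x) • (hessian f x + ε • 1) -
        ((1 / 2 : ℝ) * ∑ i, (partialDeriv f x i + ε * (x i - a i)) ^ 2) • 1 := by
  have hg := (contDiff_paraboloid a c).contDiffAt (x := x)
  have h1 := hessian_linearComb hf hg 1 ε
  have h2 := partialDeriv_linearComb (hf.differentiableAt (by norm_num))
    (hg.differentiableAt (by norm_num)) 1 ε
  simp only [one_mul, one_smul] at h1 h2
  rw [schouten, h1, hessian_paraboloid]
  simp only [h2, partialDeriv_paraboloid]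

theorem schouten_add_paraboloid_self {f : EuclideanSpace ℝ (Fin n) → ℝ}
    {x : EuclideanSpace ℝ (Fin n)} (hf : ContDiffAt ℝ 2 f x) (ε : ℝ) :
    schouten (fun y => f y + ε * paraboloid x 0 y) x = schouten f x + (ε * f x) • 1 := by
  rw [schouten_add_paraboloid hf, schouten]
  simp only [paraboloid, sub_self, norm_zero]
  ext i j
  simp only [Matrix.sub_apply, Matrix.add_apply, Matrix.smul_apply, smul_eq_mul, mul_zero, add_zero, ne_eq, 
    OfNat.ofNat_ne_zero, not_false_eq_true, zero_pow, zero_div]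
  ring

/-- Adding `ε (‖y‖² / 2 + 1)` to a positive function multiplies `A` by a factor greater than one and
adds a positive multiple of the identity. The sign rests on `2 u² + h |∇u|² - 2 u x·∇u ≥ 0` for
`h = |x|² / 2 + 1`, a consequence of the Cauchy-Schwarz inequality. -/
theorem schouten_add_paraboloid_zero {f : EuclideanSpace ℝ (Fin n) → ℝ}
    {x : EuclideanSpace ℝ (Fin n)} (hf : ContDiffAt ℝ 2 f x) (hpos : 0 < f x) {ε : ℝ}
    (hε : 0 < ε) : ∃ c : ℝ, 0 < c ∧
    schouten (fun y => f y + ε * paraboloid 0 1 y) x =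
      (1 + ε * paraboloid 0 1 x / f x) • schouten f x + c • 1 := by
  set p := fun i => partialDeriv f x i with hp
  set G := ∑ i, p i ^ 2 with hG
  set D := ∑ i, p i * x i with hD
  set R := ∑ i, x i ^ 2 with hR
  have hn : paraboloid 0 1 x = R / 2 + 1 := by
    simp [paraboloid, EuclideanSpace.norm_sq_eq, hR]
  have hCS : D ^ 2 ≤ G * R := Finset.sum_mul_sq_le_sq_mul_sq _ _ _
  have hS : ∑ i, (p i + ε * (x i - (0 : EuclideanSpace ℝ (Fin n)) i)) ^ 2
      = G + 2 * ε * D + ε ^ 2 * R := by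
    rw [hG, hD, hR, Finset.mul_sum, Finset.mul_sum, ← Finset.sum_add_distrib,
      ← Finset.sum_add_distrib]
    refine Finset.sum_congr rfl fun i _ => ?_
    simp; ring
  have hG0 : 0 ≤ G := Finset.sum_nonneg fun i _ => sq_nonneg _
  refine ⟨ε * (2 * f x ^ 2 + (R / 2 + 1) * G - 2 * f x * D) / (2 * f x) + ε ^ 2, ?_, ?_⟩
  · have : 0 ≤ 2 * f x ^ 2 + (R / 2 + 1) * G - 2 * f x * D := by
      nlinarith [sq_nonneg (D - 2 * f x)]
    positivity
  · rw [schouten_add_paraboloid hf, schouten, hn, hS]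
    ext i j
    simp only [Matrix.sub_apply, Matrix.add_apply, Matrix.smul_apply, smul_eq_mul]
    field_simp
    ring

end

/-! ### The mean value inequality for subharmonic functions -/

section

open Metric

theorem hasDerivAt_max_zero_pow_three (t : ℝ) :
    HasDerivAt (fun t : ℝ => max 0 t ^ 3) (3 * max 0 t ^ 2) t := by
  rcases lt_trichotomy t 0 with h | rfl | h
  · have h1 : HasDerivAt (fun _ : ℝ => (0 : ℝ)) (3 * max 0 t ^ 2) t := by
      rw [max_eq_left h.le]; simpa using hasDerivAt_const t (0 : ℝ)
    refine h1.congr_of_eventuallyEq ?_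
    filter_upwards [Iio_mem_nhds h] with z hz
    rw [max_eq_left (le_of_lt hz)]; norm_num
  · rw [← hasDerivWithinAt_univ, ← Set.Iic_union_Ici (a := (0 : ℝ))]
    have h1 : HasDerivAt (fun _ : ℝ => (0 : ℝ)) (3 * max 0 0 ^ 2) 0 := by
      simpa using hasDerivAt_const (0 : ℝ) (0 : ℝ)
    have h2 : HasDerivAt (fun t : ℝ => t ^ 3) (3 * max 0 0 ^ 2) 0 := by
      simpa using hasDerivAt_pow 3 (0 : ℝ)
    refine HasDerivWithinAt.union ?_ ?_
    · refine h1.hasDerivWithinAt.congr (fun z hz => ?_) (by simp)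
      rw [max_eq_left hz]; norm_num
    · refine h2.hasDerivWithinAt.congr (fun z hz => ?_) (by simp)
      rw [max_eq_right hz]
  · have h1 : HasDerivAt (fun t : ℝ => t ^ 3) (3 * max 0 t ^ 2) t := by
      rw [max_eq_right h.le]; simpa using hasDerivAt_pow 3 t
    refine h1.congr_of_eventuallyEq ?_
    filter_upwards [Ioi_mem_nhds h] with z hz
    rw [max_eq_right (le_of_lt hz)]

/-- The radial bump `(1 - ‖y‖²)₊³`; its gradient is `-y` times `radialKernel`. -/
def radialBump (y : EuclideanSpace ℝ (Fin n)) : ℝ := max 0 (1 - ‖y‖ ^ 2) ^ 3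

/-- The radial weight `6 (1 - ‖y‖²)₊²`, supported in the closed unit ball and not normalized. -/
def radialKernel (y : EuclideanSpace ℝ (Fin n)) : ℝ := 6 * max 0 (1 - ‖y‖ ^ 2) ^ 2

theorem hasFDerivAt_radialBump (y : EuclideanSpace ℝ (Fin n)) :
    HasFDerivAt radialBump (-radialKernel y • innerSL ℝ y) y := by
  have h1 := ((hasFDerivAt_id y).norm_sq).const_sub (1 : ℝ)
  have h2 := (hasDerivAt_max_zero_pow_three (1 - ‖y‖ ^ 2)).comp_hasFDerivAt y h1
  refine h2.congr_fderiv ?_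
  ext z
  simp [radialKernel]
  ring

theorem radialBump_nonneg (y : EuclideanSpace ℝ (Fin n)) : 0 ≤ radialBump y := by
  unfold radialBump; positivity

theorem radialKernel_nonneg (y : EuclideanSpace ℝ (Fin n)) : 0 ≤ radialKernel y := by
  unfold radialKernel; positivity

theorem radialKernel_le (y : EuclideanSpace ℝ (Fin n)) : radialKernel y ≤ 6 := by
  unfold radialKernel
  have h1 : max 0 (1 - ‖y‖ ^ 2) ≤ 1 := max_le zero_le_one (by nlinarith [norm_nonneg y])
  have h2 : 0 ≤ max 0 (1 - ‖y‖ ^ 2) := le_max_left _ _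
  nlinarith

theorem continuous_radialBump : Continuous (radialBump (n := n)) := by
  unfold radialBump; fun_prop

theorem continuous_radialKernel : Continuous (radialKernel (n := n)) := by
  unfold radialKernel; fun_prop

theorem max_eq_zero_of_notMem_closedBall {y : EuclideanSpace ℝ (Fin n)}
    (hy : y ∉ closedBall (0 : EuclideanSpace ℝ (Fin n)) 1) : max 0 (1 - ‖y‖ ^ 2) = 0 := by
  rw [mem_closedBall_zero_iff, not_le] at hy
  exact max_eq_left (by nlinarith)

theorem radialBump_eq_zero {y : EuclideanSpace ℝ (Fin n)}
    (hy : y ∉ closedBall (0 : EuclideanSpace ℝ (Fin n)) 1) : radialBump y = 0 := by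
  rw [radialBump, max_eq_zero_of_notMem_closedBall hy]; norm_num

theorem radialKernel_eq_zero {y : EuclideanSpace ℝ (Fin n)}
    (hy : y ∉ closedBall (0 : EuclideanSpace ℝ (Fin n)) 1) : radialKernel y = 0 := by
  rw [radialKernel, max_eq_zero_of_notMem_closedBall hy]; norm_num

theorem integrable_mul_of_continuousOn {g H : EuclideanSpace ℝ (Fin n) → ℝ}
    (hg : ContinuousOn g (closedBall 0 1)) (hH : Continuous H)
    (h0 : ∀ y ∉ closedBall (0 : EuclideanSpace ℝ (Fin n)) 1, H y = 0) :
    Integrable (fun y => g y * H y) := by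
  have h1 : IntegrableOn (fun y => g y * H y) (closedBall 0 1) :=
    (hg.mul hH.continuousOn).integrableOn_compact (isCompact_closedBall _ _)
  refine (integrableOn_iff_integrable_of_support_subset ?_).1 h1
  intro y hy
  by_contra hc
  exact hy (by simp [h0 y hc])

theorem integral_radialKernel_pos : 0 < ∫ y, radialKernel (n := n) y := by
  have hi : Integrable (radialKernel (n := n)) := by
    simpa using integrable_mul_of_continuousOn (g := fun _ => 1) continuousOn_const
      continuous_radialKernel fun y hy => radialKernel_eq_zero hy
  refine continuous_radialKernel.integral_pos_of_hasCompactSupport_nonneg_nonzero ?_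
    radialKernel_nonneg (x := 0) (by simp [radialKernel])
  exact HasCompactSupport.of_support_subset_isCompact (isCompact_closedBall 0 1) fun y hy => by
    by_contra hc; exact hy (radialKernel_eq_zero hc)

theorem add_smul_mem_ball {x y : EuclideanSpace ℝ (Fin n)} {δ R : ℝ}
    (hδ : |δ| < R) (hy : y ∈ closedBall (0 : EuclideanSpace ℝ (Fin n)) 1) :
    x + δ • y ∈ ball x R := by
  rw [mem_closedBall_zero_iff] at hy
  rw [mem_ball, dist_self_add_left, norm_smul, Real.norm_eq_abs]
  nlinarith [abs_nonneg δ, norm_nonneg y]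

theorem add_smul_mem_closedBall {x y : EuclideanSpace ℝ (Fin n)} {δ R : ℝ}
    (hδ : |δ| ≤ R) (hy : y ∈ closedBall (0 : EuclideanSpace ℝ (Fin n)) 1) :
    x + δ • y ∈ closedBall x R := by
  rw [mem_closedBall_zero_iff] at hy
  rw [mem_closedBall, dist_self_add_left, norm_smul, Real.norm_eq_abs]
  nlinarith [abs_nonneg δ, norm_nonneg y]

/-- The mean of `f` over the ball of radius `δ` about `x`, weighted with `radialKernel` and not
normalized. -/
def radialMean (f : EuclideanSpace ℝ (Fin n) → ℝ) (x : EuclideanSpace ℝ (Fin n)) (δ : ℝ) : ℝ :=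
  ∫ y in closedBall 0 1, f (x + δ • y) * radialKernel y

theorem hasDerivAt_radialMean {f : EuclideanSpace ℝ (Fin n) → ℝ} {x : EuclideanSpace ℝ (Fin n)}
    {R : ℝ} (hf : ContDiffOn ℝ 2 f (ball x R)) {δ : ℝ} (hδ : |δ| < R) :
    HasDerivAt (radialMean f x)
      (∫ y in closedBall 0 1, fderiv ℝ f (x + δ • y) y * radialKernel y) δ := by
  obtain ⟨r, hr1, hr2⟩ := exists_between hδ
  have hr0 : 0 < r := (abs_nonneg δ).trans_lt hr1
  have hsub : closedBall x r ⊆ ball x R := closedBall_subset_ball hr2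
  have hfd : ContinuousOn (fderiv ℝ f) (ball x R) :=
    hf.continuousOn_fderiv_of_isOpen isOpen_ball (by norm_num)
  obtain ⟨C, hC⟩ := (isCompact_closedBall x r).exists_bound_of_continuousOn (hfd.mono hsub)
  have hmeas : MeasurableSet (closedBall (0 : EuclideanSpace ℝ (Fin n)) 1) :=
    isClosed_closedBall.measurableSet
  have hcont : ∀ t, |t| < R → ContinuousOn (fun y => f (x + t • y) * radialKernel y)
      (closedBall 0 1) := fun t ht =>
    ((hf.continuousOn.comp (by fun_prop) fun y hy => add_smul_mem_ball ht hy)).mul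
      continuous_radialKernel.continuousOn
  refine (hasDerivAt_integral_of_dominated_loc_of_deriv_le (F := fun t y =>
    f (x + t • y) * radialKernel y) (F' := fun t y => fderiv ℝ f (x + t • y) y * radialKernel y)
    (bound := fun _ => C * 6)
    (s := Set.Ioo (-r) r) (Ioo_mem_nhds (abs_lt.1 hr1).1 (abs_lt.1 hr1).2) ?_ ?_ ?_ ?_ ?_ ?_).2
  · filter_upwards [Ioo_mem_nhds (abs_lt.1 hδ).1 (abs_lt.1 hδ).2] with t ht
    exact (hcont t (abs_lt.2 ht)).aestronglyMeasurable hmeas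
  · exact (hcont δ hδ).integrableOn_compact (isCompact_closedBall _ _)
  · refine ContinuousOn.aestronglyMeasurable ?_ hmeas
    refine ContinuousOn.mul ?_ continuous_radialKernel.continuousOn
    exact (hfd.comp (by fun_prop) fun y hy => add_smul_mem_ball hδ hy).clm_apply continuousOn_id
  · filter_upwards [ae_restrict_mem hmeas] with y hy t ht
    have h1 := hC _ (add_smul_mem_closedBall (x := x) (abs_lt.2 ht).le hy)
    have h2 := (fderiv ℝ f (x + t • y)).le_opNorm y
    rw [mem_closedBall_zero_iff] at hy
    rw [norm_mul, Real.norm_of_nonneg (radialKernel_nonneg y)]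
    have hC0 : 0 ≤ C := (norm_nonneg _).trans h1
    refine mul_le_mul ?_ (radialKernel_le y) (radialKernel_nonneg y) hC0
    calc _ ≤ _ := h2
      _ ≤ C * 1 := mul_le_mul h1 hy (norm_nonneg _) hC0
      _ = C := mul_one C
  · exact continuousOn_const.integrableOn_compact (isCompact_closedBall _ _)
  · filter_upwards [ae_restrict_mem hmeas] with y hy t ht
    have h1 : HasDerivAt (fun t : ℝ => x + t • y) y t :=
      (((hasDerivAt_id t).smul_const y).const_add x).congr_deriv (one_smul ℝ y)
    have hm := hsub (add_smul_mem_closedBall (x := x) (abs_lt.2 ht).le hy)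
    have h2 := ((hf.contDiffAt (isOpen_ball.mem_nhds hm)).differentiableAt (by norm_num)).hasFDerivAt
    exact (h2.comp_hasDerivAt t h1).mul_const _

/-- The means of a subharmonic function increase with the radius: as `y * radialKernel y` is minus the
gradient of `radialBump`, an integration by parts turns the derivative of the mean into
`δ ∫ Δf (x + δ y) * radialBump y`. -/
theorem deriv_radialMean_nonneg {f : EuclideanSpace ℝ (Fin n) → ℝ}
    {x : EuclideanSpace ℝ (Fin n)} {R : ℝ} (hf : ContDiffOn ℝ 2 f (ball x R))
    (hsub : ∀ y ∈ ball x R, 0 ≤ (hessian f y).trace) {δ : ℝ} (hδ0 : 0 < δ) (hδ : δ < R) :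
    0 ≤ ∫ y in closedBall 0 1, fderiv ℝ f (x + δ • y) y * radialKernel y := by
  have hδ' : |δ| < R := by rwa [abs_of_pos hδ0]
  have hCD : ∀ y ∈ closedBall (0 : EuclideanSpace ℝ (Fin n)) 1, ContDiffAt ℝ 2 f (x + δ • y) :=
    fun y hy => hf.contDiffAt (isOpen_ball.mem_nhds (add_smul_mem_ball hδ' hy))
  have hmap : ∀ y, HasFDerivAt (fun y : EuclideanSpace ℝ (Fin n) => x + δ • y)
      (δ • ContinuousLinearMap.id ℝ (EuclideanSpace ℝ (Fin n))) y := fun y =>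
    ((hasFDerivAt_id y).const_smul δ).const_add x
  set p : Fin n → EuclideanSpace ℝ (Fin n) → ℝ := fun i y => partialDeriv f (x + δ • y) i with hp
  have hpd : ∀ i, ∀ y ∈ closedBall (0 : EuclideanSpace ℝ (Fin n)) 1,
      DifferentiableAt ℝ (p i) y ∧
        fderiv ℝ (p i) y (EuclideanSpace.single i 1) = δ * hessian f (x + δ • y) i i := by
    intro i y hy
    have h1 : DifferentiableAt ℝ (fun z => partialDeriv f z i) (x + δ • y) :=
      (((hCD y hy).fderiv_right (m := 1) (by norm_num)).differentiableAt (by norm_num)).clm_apply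
        (differentiableAt_const _)
    have h2 : HasFDerivAt (p i) (fderiv ℝ (fun z => partialDeriv f z i) (x + δ • y) ∘SL
        (δ • ContinuousLinearMap.id ℝ (EuclideanSpace ℝ (Fin n)))) y :=
      HasFDerivAt.comp (g := fun z => partialDeriv f z i) (f := fun y => x + δ • y) y
        h1.hasFDerivAt (hmap y)
    refine ⟨h2.differentiableAt, ?_⟩
    rw [h2.fderiv]
    simp [hessian, partialDeriv]
  have hpc : ∀ i, ContinuousOn (p i) (closedBall 0 1) := fun i y hy =>
    (hpd i y hy).1.continuousAt.continuousWithinAt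
  have hhc : ∀ i, ContinuousOn (fun y => δ * hessian f (x + δ • y) i i) (closedBall 0 1) := by
    intro i y hy
    have h2 : ContinuousAt (fun z => hessian f z i i) (x + δ • y) :=
      continuousAt_pi.1 (continuousAt_pi.1 (continuousAt_hessian (hCD y hy)) i) i
    exact (continuousAt_const.mul
      (ContinuousAt.comp (f := fun y => x + δ • y) h2
        (hmap y).continuousAt)).continuousWithinAt
  have hGd : ∀ i y, fderiv ℝ (radialBump (n := n)) y (EuclideanSpace.single i 1) =
      -(radialKernel y * y i) := by
    intro i y
    rw [(hasFDerivAt_radialBump y).fderiv]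
    simp [EuclideanSpace.inner_single_right]
  have hts : tsupport (radialBump (n := n)) ⊆ closedBall 0 1 :=
    closure_minimal (fun y hy => by by_contra hc; exact hy (radialBump_eq_zero hc))
      isClosed_closedBall
  have hF'G : ∀ i, Integrable fun y => δ * hessian f (x + δ • y) i i * radialBump y := fun i =>
    integrable_mul_of_continuousOn (hhc i) continuous_radialBump fun y hy => radialBump_eq_zero hy
  have hF'G' : ∀ i, (fun y => fderiv ℝ (p i) y (EuclideanSpace.single i 1) * radialBump y) =
      fun y => δ * hessian f (x + δ • y) i i * radialBump y := by
    intro i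
    funext y
    by_cases hy : y ∈ closedBall (0 : EuclideanSpace ℝ (Fin n)) 1
    · rw [(hpd i y hy).2]
    · rw [radialBump_eq_zero hy, mul_zero, mul_zero]
  have hFG' : ∀ i, Integrable fun y =>
      p i y * fderiv ℝ (radialBump (n := n)) y (EuclideanSpace.single i 1) := by
    intro i
    simp_rw [hGd]
    refine integrable_mul_of_continuousOn (hpc i)
      (continuous_radialKernel.mul (by fun_prop)).neg fun y hy => ?_
    rw [radialKernel_eq_zero hy]; simp
  have hparts : ∀ i, ∫ y, p i y * fderiv ℝ (radialBump (n := n)) y (EuclideanSpace.single i 1) =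
      -∫ y, δ * hessian f (x + δ • y) i i * radialBump y := by
    intro i
    rw [integral_mul_fderiv_eq_neg_fderiv_mul_of_integrable (by rw [hF'G' i]; exact hF'G i)
      (hFG' i) (integrable_mul_of_continuousOn (hpc i) continuous_radialBump
        fun y hy => radialBump_eq_zero hy) (fun y hy => (hpd i y (hts hy)).1)
      (fun y _ => (hasFDerivAt_radialBump y).differentiableAt), hF'G' i]
  have hexp : ∀ y, fderiv ℝ f (x + δ • y) y * radialKernel y =
      -∑ i, p i y * fderiv ℝ (radialBump (n := n)) y (EuclideanSpace.single i 1) := by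
    intro y
    have h1 : fderiv ℝ f (x + δ • y) y = ∑ i, y i * p i y := by
      conv_lhs => arg 2; rw [eq_sum_smul_single y]
      simp only [map_sum, map_smul, smul_eq_mul, hp, partialDeriv]
    rw [h1, Finset.sum_mul, ← Finset.sum_neg_distrib]
    refine Finset.sum_congr rfl fun i _ => ?_
    rw [hGd]
    ring
  rw [setIntegral_eq_integral_of_forall_compl_eq_zero
    (fun y hy => by rw [radialKernel_eq_zero hy, mul_zero])]
  simp_rw [hexp]
  rw [integral_neg, integral_finsetSum _ fun i _ => hFG' i]
  simp_rw [hparts]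
  rw [Finset.sum_neg_distrib, neg_neg, ← integral_finsetSum _ fun i _ => hF'G i]
  refine integral_nonneg fun y => ?_
  by_cases hy : y ∈ closedBall (0 : EuclideanSpace ℝ (Fin n)) 1
  · have h1 := hsub _ (add_smul_mem_ball hδ' hy)
    have h2 : ∑ i, δ * hessian f (x + δ • y) i i * radialBump y =
        δ * radialBump y * (hessian f (x + δ • y)).trace := by
      rw [Matrix.trace, Finset.mul_sum]
      exact Finset.sum_congr rfl fun i _ => by rw [Matrix.diag_apply]; ring
    simp only [Pi.zero_apply, h2]
    exact mul_nonneg (mul_nonneg hδ0.le (radialBump_nonneg y)) h1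
  · simp [radialBump_eq_zero hy]

/-- The mean value inequality for `C²` subharmonic functions. -/
theorem mul_integral_radialKernel_le {f : EuclideanSpace ℝ (Fin n) → ℝ}
    {x : EuclideanSpace ℝ (Fin n)} {R : ℝ} (hf : ContDiffOn ℝ 2 f (ball x R))
    (hsub : ∀ y ∈ ball x R, 0 ≤ (hessian f y).trace) {s : ℝ} (hs0 : 0 < s) (hs : s < R) :
    f x * ∫ y, radialKernel (n := n) y ≤ radialMean f x s := by
  have hmono : MonotoneOn (radialMean f x) (Set.Icc 0 s) := by
    have hd : ∀ δ ∈ Set.Icc 0 s, HasDerivAt (radialMean f x) _ δ := fun δ h =>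
      hasDerivAt_radialMean hf (by rw [abs_of_nonneg h.1]; exact h.2.trans_lt hs)
    refine monotoneOn_of_deriv_nonneg (convex_Icc 0 s)
      (fun δ h => (hd δ h).continuousAt.continuousWithinAt)
      (fun δ h => (hd δ (interior_subset h)).differentiableAt.differentiableWithinAt) ?_
    intro δ h
    rw [(hd δ (interior_subset h)).deriv]
    rw [interior_Icc] at h
    exact deriv_radialMean_nonneg hf hsub h.1 (h.2.trans hs)
  have h0 : radialMean f x 0 = f x * ∫ y, radialKernel (n := n) y := by
    simp only [radialMean, zero_smul, add_zero]
    rw [integral_const_mul, setIntegral_eq_integral_of_forall_compl_eq_zero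
      fun y hy => radialKernel_eq_zero hy]
  rw [← h0]
  exact hmono ⟨le_rfl, hs0.le⟩ ⟨hs0.le, le_rfl⟩ hs0.le

theorem setIntegral_closedBall_comp (g : EuclideanSpace ℝ (Fin n) → ℝ)
    (x : EuclideanSpace ℝ (Fin n)) {s : ℝ} (hs : 0 < s) :
    ∫ y in closedBall 0 1, g (x + s • y) = (s ^ n)⁻¹ * ∫ y in closedBall x s, g y := by
  rw [← integral_indicator isClosed_closedBall.measurableSet,
    ← integral_indicator isClosed_closedBall.measurableSet]
  have h1 : (closedBall (0 : EuclideanSpace ℝ (Fin n)) 1).indicator (fun y => g (x + s • y)) =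
      fun y => (fun z => (closedBall x s).indicator g (x + z)) (s • y) := by
    funext y
    have : y ∈ closedBall (0 : EuclideanSpace ℝ (Fin n)) 1 ↔ x + s • y ∈ closedBall x s := by
      rw [mem_closedBall_zero_iff, mem_closedBall, dist_self_add_left, norm_smul,
        Real.norm_of_nonneg hs.le]
      exact (mul_le_iff_le_one_right hs).symm
    by_cases hy : y ∈ closedBall (0 : EuclideanSpace ℝ (Fin n)) 1
    · simp only [Set.indicator_of_mem hy, Set.indicator_of_mem (this.1 hy)]
    · simp only [Set.indicator_of_notMem hy, Set.indicator_of_notMem (fun h => hy (this.2 h))]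
  rw [h1, Measure.integral_comp_smul volume (fun z => (closedBall x s).indicator g (x + z)) s,
    integral_add_left_eq_self, finrank_euclideanSpace_fin, abs_of_pos (by positivity), smul_eq_mul]

/-- A subharmonic function that is `L¹`-close to a function bounded by `b` on a ball exceeds `b` only
slightly at the centre. -/
theorem le_add_integral_abs_sub {f u : EuclideanSpace ℝ (Fin n) → ℝ}
    {x : EuclideanSpace ℝ (Fin n)} {R : ℝ} (hf : ContDiffOn ℝ 2 f (ball x R))
    (hsub : ∀ y ∈ ball x R, 0 ≤ (hessian f y).trace) {s : ℝ} (hs0 : 0 < s) (hs : s < R)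
    (hu : ContinuousOn u (closedBall x s)) {b : ℝ} (hb : ∀ y ∈ closedBall x s, u y ≤ b) :
    f x ≤ b + 6 / (∫ y, radialKernel (n := n) y) * (s ^ n)⁻¹ *
      ∫ y in closedBall x s, |f y - u y| := by
  have hI := integral_radialKernel_pos (n := n)
  set I := ∫ y, radialKernel (n := n) y with hIdef
  have h1 := mul_integral_radialKernel_le hf hsub hs0 hs
  rw [← hIdef] at h1
  have hfc : ContinuousOn f (closedBall x s) := hf.continuousOn.mono (closedBall_subset_ball hs)
  have hmaps : ∀ y ∈ closedBall (0 : EuclideanSpace ℝ (Fin n)) 1, x + s • y ∈ closedBall x s :=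
    fun y hy => add_smul_mem_closedBall (abs_of_pos hs0).le hy
  have hcf : ContinuousOn (fun y => f (x + s • y)) (closedBall 0 1) :=
    hfc.comp (by fun_prop) hmaps
  have hcu : ContinuousOn (fun y => u (x + s • y)) (closedBall 0 1) :=
    hu.comp (by fun_prop) hmaps
  have hB := isCompact_closedBall (0 : EuclideanSpace ℝ (Fin n)) 1
  have hk := (continuous_radialKernel (n := n)).continuousOn (s := closedBall 0 1)
  have hi1 : IntegrableOn (fun y => b * radialKernel y)
      (closedBall (0 : EuclideanSpace ℝ (Fin n)) 1) :=
    (continuousOn_const.mul hk).integrableOn_compact hB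
  have hi2 : IntegrableOn (fun y => 6 * |f (x + s • y) - u (x + s • y)|) (closedBall 0 1) :=
    (continuousOn_const.mul (hcf.sub hcu).abs).integrableOn_compact hB
  have h2 : radialMean f x s ≤ ∫ y in closedBall 0 1,
      (b * radialKernel y + 6 * |f (x + s • y) - u (x + s • y)|) := by
    refine setIntegral_mono_on ((hcf.mul hk).integrableOn_compact hB) (hi1.add hi2)
      isClosed_closedBall.measurableSet fun y hy => ?_
    have h3 := hb _ (hmaps y hy)
    have h4 := radialKernel_nonneg y
    have h5 := radialKernel_le y
    have h6 := le_abs_self (f (x + s • y) - u (x + s • y))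
    have h7 := abs_nonneg (f (x + s • y) - u (x + s • y))
    nlinarith [mul_le_mul_of_nonneg_right h5 h7, mul_le_mul_of_nonneg_left h6 h4,
      mul_le_mul_of_nonneg_left h3 h4]
  rw [integral_add hi1 hi2, integral_const_mul,
    integral_const_mul, setIntegral_closedBall_comp (fun z => |f z - u z|) x hs0,
    setIntegral_eq_integral_of_forall_compl_eq_zero fun y hy => radialKernel_eq_zero hy,
    ← hIdef] at h2
  refine le_of_mul_le_mul_right (h1.trans (h2.trans (le_of_eq ?_))) hI
  field_simp

end

/-! ### The cone condition for `C²` limits -/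

section

open Metric

/-- If `f > θ g` somewhere on the compact set `K` but not on `K \ O`, then some multiple `M g` with
`M > θ` touches `f` from above at a point of `O`. Here `M` is the maximum of `f / g`. -/
theorem exists_touching {K O : Set (EuclideanSpace ℝ (Fin n))}
    {f g : EuclideanSpace ℝ (Fin n) → ℝ} (hK : IsCompact K) (hf : ContinuousOn f K)
    (hg : ContinuousOn g K) (hg0 : ∀ y ∈ K, 0 < g y) {θ : ℝ} (hy : ∃ y ∈ K, θ * g y < f y)
    (hb : ∀ z ∈ K, z ∉ O → f z ≤ θ * g z) :
    ∃ z ∈ K, z ∈ O ∧ ∃ M, θ < M ∧ f z = M * g z ∧ ∀ y ∈ K, f y ≤ M * g y := by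
  obtain ⟨y, hyK, hy⟩ := hy
  obtain ⟨z, hz, hmax⟩ := hK.exists_isMaxOn ⟨y, hyK⟩
    (hf.div hg fun y hy => (hg0 y hy).ne')
  have hθ : θ < f z / g z := ((lt_div_iff₀ (hg0 y hyK)).2 hy).trans_le (hmax hyK)
  refine ⟨z, hz, ?_, f z / g z, hθ, (div_mul_cancel₀ _ (hg0 z hz).ne').symm, fun w hw =>
    (div_le_iff₀ (hg0 w hw)).1 (hmax hw)⟩
  by_contra hzO
  exact absurd ((div_le_iff₀ (hg0 z hz)).2 (hb z hz hzO)) (not_le.2 hθ)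

/-- Functions `f > 0` with `A(f) ∈ Γ_k`, `k ≥ 1`, are subharmonic, since `σ_1` is
`f Δf - (n / 2) |∇f|²`. -/
theorem trace_hessian_nonneg {f : EuclideanSpace ℝ (Fin n) → ℝ} {x : EuclideanSpace ℝ (Fin n)}
    (hf : ContDiffAt ℝ 2 f x) (hpos : 0 < f x) {k : ℕ} (hk : 1 ≤ k)
    (hG : eigenvalues (schouten f x) ∈ gardingCone k) : 0 ≤ (hessian f x).trace := by
  have h1 := hG 1 le_rfl hk
  have h2 : (eigenvalues (schouten f x)).esymm 1 = (schouten f x).trace := by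
    rw [(isHermitian_schouten hf).trace_eq_sum_eigenvalues,
      eigenvalues_eq_map (isHermitian_schouten hf), Finset.esymm_map_val]
    simp [Finset.powersetCard_one]
  rw [h2, schouten, Matrix.trace_sub, Matrix.trace_smul, Matrix.trace_smul, Matrix.trace_one,
    smul_eq_mul, smul_eq_mul] at h1
  have h3 : 0 ≤ 1 / 2 * (∑ i, partialDeriv f x i ^ 2) * ((Fintype.card (Fin n) : ℕ) : ℝ) := by
    have : 0 ≤ ∑ i, partialDeriv f x i ^ 2 := Finset.sum_nonneg fun i _ => sq_nonneg _
    positivity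
  exact nonneg_of_mul_nonneg_right (by linarith : 0 ≤ f x * (hessian f x).trace) hpos

theorem tendsto_integral_abs_sub {Ω K : Set (EuclideanSpace ℝ (Fin n))}
    {U : ℕ → EuclideanSpace ℝ (Fin n) → ℝ} {u : EuclideanSpace ℝ (Fin n) → ℝ}
    (hU : ∀ m, ContinuousOn (U m) Ω) (hu : ContinuousOn u Ω) (hK : IsCompact K) (hKΩ : K ⊆ Ω)
    (h : Tendsto (fun m => ∫⁻ x in K, ‖U m x - u x‖ₑ) atTop (𝓝 0)) :
    Tendsto (fun m => ∫ x in K, |U m x - u x|) atTop (𝓝 0) := by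
  have h1 := (ENNReal.tendsto_toReal ENNReal.zero_ne_top).comp h
  refine h1.congr fun m => ?_
  have h2 := integral_norm_eq_lintegral_enorm (μ := volume.restrict K)
    ((((hU m).mono hKΩ).sub (hu.mono hKΩ)).aestronglyMeasurable hK.measurableSet)
  exact h2.symm

/-- For subharmonic functions, `L¹` convergence to a continuous function gives a locally uniform upper
bound. -/
theorem eventually_forall_le_add {Ω : Set (EuclideanSpace ℝ (Fin n))}
    {U : ℕ → EuclideanSpace ℝ (Fin n) → ℝ} {u : EuclideanSpace ℝ (Fin n) → ℝ}
    (hU : ∀ m, ContDiffOn ℝ 2 (U m) Ω)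
    (hsub : ∀ m, ∀ y ∈ Ω, 0 ≤ (hessian (U m) y).trace) (hu : ContinuousOn u Ω)
    {x₀ : EuclideanSpace ℝ (Fin n)} {r : ℝ} (hr : 0 < r) (hball : closedBall x₀ (2 * r) ⊆ Ω)
    (h : Tendsto (fun m => ∫ x in closedBall x₀ (2 * r), |U m x - u x|) atTop (𝓝 0))
    {η : ℝ} (hη : 0 < η) :
    ∀ᶠ m in atTop, ∀ z ∈ closedBall x₀ r, U m z ≤ u z + η := by
  have hK := isCompact_closedBall x₀ (2 * r)
  have huc := hK.uniformContinuousOn_of_continuous (hu.mono hball)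
  obtain ⟨s', hs', hus⟩ := Metric.uniformContinuousOn_iff_le.1 huc (η / 2) (by positivity)
  set s := min s' (r / 2) with hs
  have hs0 : 0 < s := lt_min hs' (by positivity)
  have hsr : s < r := (min_le_right _ _).trans_lt (by linarith)
  set C := 6 / (∫ y, radialKernel (n := n) y) * (s ^ n)⁻¹ with hC
  have hC0 : 0 ≤ C := by
    have := integral_radialKernel_pos (n := n)
    positivity
  have h1 : Tendsto (fun m => C * ∫ x in closedBall x₀ (2 * r), |U m x - u x|) atTop (𝓝 0) := by
    simpa using h.const_mul C
  filter_upwards [h1.eventually_le_const (by positivity : 0 < η / 2)] with m hm z hz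
  have hsubK : ∀ {R : ℝ}, R ≤ r → closedBall z R ⊆ closedBall x₀ (2 * r) := fun hR =>
    closedBall_subset_closedBall' (by rw [mem_closedBall] at hz; linarith)
  have hzΩ : ball z r ⊆ Ω := ball_subset_closedBall.trans ((hsubK le_rfl).trans hball)
  have h2 := le_add_integral_abs_sub (u := u) ((hU m).mono hzΩ) (fun y hy => hsub m y (hzΩ hy)) hs0
    hsr (hu.mono ((hsubK hsr.le).trans hball)) (b := u z + η / 2) (fun y hy => by
      have h3 := hus y (hsubK hsr.le hy) z (hsubK hsr.le (mem_closedBall_self hs0.le))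
        ((mem_closedBall.1 hy).trans (min_le_left _ _))
      rw [Real.dist_eq] at h3
      linarith [le_abs_self (u y - u z)])
  have h4 : ∫ y in closedBall z s, |U m y - u y| ≤
      ∫ y in closedBall x₀ (2 * r), |U m y - u y| :=
    setIntegral_mono_set
      ((((hU m).continuousOn.mono hball).sub (hu.mono hball)).abs.integrableOn_compact hK)
      (.of_forall fun y => abs_nonneg _) (hsubK hsr.le).eventuallyLE
  have h5 := mul_le_mul_of_nonneg_left h4 hC0
  linarith

theorem eventually_exists_sub_le {Ω : Set (EuclideanSpace ℝ (Fin n))}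
    {U : ℕ → EuclideanSpace ℝ (Fin n) → ℝ} {u : EuclideanSpace ℝ (Fin n) → ℝ}
    (hU : ∀ m, ContinuousOn (U m) Ω) (hu : ContinuousOn u Ω)
    {x₀ : EuclideanSpace ℝ (Fin n)} {R ρ : ℝ} (hρ : 0 < ρ) (hρR : ρ ≤ R)
    (hball : closedBall x₀ R ⊆ Ω)
    (h : Tendsto (fun m => ∫ x in closedBall x₀ R, |U m x - u x|) atTop (𝓝 0))
    {η : ℝ} (hη : 0 < η) :
    ∀ᶠ m in atTop, ∃ y ∈ closedBall x₀ ρ, u y - η ≤ U m y := by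
  have hK := isCompact_closedBall x₀ R
  have hv : 0 < volume.real (closedBall x₀ ρ) :=
    ENNReal.toReal_pos (measure_closedBall_pos volume x₀ hρ).ne' measure_closedBall_lt_top.ne
  filter_upwards [h.eventually_lt_const (mul_pos hη hv)] with m hm
  by_contra! hc
  have hsub : closedBall x₀ ρ ⊆ closedBall x₀ R := closedBall_subset_closedBall hρR
  have hi := (((hU m).mono hball).sub (hu.mono hball)).abs.integrableOn_compact (μ := volume) hK
  have h1 : ∫ y in closedBall x₀ ρ, |U m y - u y| ≤ ∫ y in closedBall x₀ R, |U m y - u y| :=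
    setIntegral_mono_set hi (.of_forall fun y => abs_nonneg _) hsub.eventuallyLE
  have h2 : η * volume.real (closedBall x₀ ρ) ≤ ∫ y in closedBall x₀ ρ, |U m y - u y| := by
    refine setIntegral_ge_of_const_le_real isClosed_closedBall.measurableSet
      measure_closedBall_lt_top.ne (fun y hy => ?_) (hi.mono_set hsub)
    have := hc y hy
    rw [abs_sub_comm]
    exact le_trans (by linarith) (le_abs_self _)
  linarith

/-- If `U m → u` in `L¹` near `x₀` with `U m` in the class `PhiTilde`, then arbitrarily close to `x₀`
there are points where `u + δ ‖y - x₀‖² / 2` satisfies the cone condition: a multiple of this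
function touches `U m` from above there. -/
theorem exists_mem_ball_of_tendsto {Ω : Set (EuclideanSpace ℝ (Fin n))} (hΩ : IsOpen Ω) {k : ℕ}
    (hk : 1 ≤ k) (hkn : k ≤ n) {U : ℕ → EuclideanSpace ℝ (Fin n) → ℝ}
    {u : EuclideanSpace ℝ (Fin n) → ℝ} (hU : ∀ m, U m ∈ PhiTilde k Ω) (hu : ContDiffOn ℝ 2 u Ω)
    (hpos : ∀ x ∈ Ω, 0 < u x) {x₀ : EuclideanSpace ℝ (Fin n)} {r : ℝ} (hr : 0 < r)
    (hball : closedBall x₀ (2 * r) ⊆ Ω)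
    (h : Tendsto (fun m => ∫ x in closedBall x₀ (2 * r), |U m x - u x|) atTop (𝓝 0))
    {δ : ℝ} (hδ : 0 < δ) :
    ∃ x ∈ ball x₀ r,
      eigenvalues (schouten (fun y => u y + δ * paraboloid x₀ 0 y) x) ∈ gardingCone k := by
  have hK := isCompact_closedBall x₀ r
  have hKΩ : closedBall x₀ r ⊆ Ω :=
    (closedBall_subset_closedBall (by linarith)).trans hball
  have hne : (closedBall x₀ r).Nonempty := ⟨x₀, mem_closedBall_self hr.le⟩
  have huK := hu.continuousOn.mono hKΩ
  obtain ⟨a, haK, ha⟩ := hK.exists_isMinOn hne huK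
  obtain ⟨b, hbK, hb⟩ := hK.exists_isMaxOn hne huK
  have ha0 := hpos a (hKΩ haK)
  have hb0 := hpos b (hKΩ hbK)
  -- With `φ = u + δ ‖y - x₀‖² / 2` the ratio `U m / φ` stays below `1 - κ` on the sphere of radius
  -- `r`, but exceeds `1 - κ` at some point within distance `ρ` of `x₀`, where `φ` is close to `u`.
  set κ := min (1 / 2) (δ * r ^ 2 / (8 * u b)) with hκ
  have hκ0 : 0 < κ := lt_min (by norm_num) (by positivity)
  have hκ1 : κ ≤ 1 / 2 := min_le_left _ _
  have hκ2 : κ * u b ≤ δ * r ^ 2 / 8 := by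
    have : κ * u b ≤ δ * r ^ 2 / (8 * u b) * u b :=
      mul_le_mul_of_nonneg_right (min_le_right _ _) hb0.le
    refine this.trans (le_of_eq ?_)
    field_simp
  set η := min (δ * r ^ 2 / 16) (κ * u a / 4) with hη
  have hη0 : 0 < η := lt_min (by positivity) (by positivity)
  have hη1 : η ≤ δ * r ^ 2 / 16 := min_le_left _ _
  have hη2 : η ≤ κ * u a / 4 := min_le_right _ _
  obtain ⟨ρ, hρ0, hρr, hρ⟩ : ∃ ρ, 0 < ρ ∧ ρ ≤ r ∧ δ * ρ ^ 2 ≤ κ * u a := by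
    refine ⟨min r (Real.sqrt (κ * u a / δ)), lt_min hr (Real.sqrt_pos.2 (by positivity)),
      min_le_left _ _, ?_⟩
    have h1 : (min r (Real.sqrt (κ * u a / δ))) ^ 2 ≤ κ * u a / δ :=
      (pow_le_pow_left₀ (le_min hr.le (Real.sqrt_nonneg _)) (min_le_right _ _) 2).trans
        (Real.sq_sqrt (by positivity)).le
    calc _ ≤ δ * (κ * u a / δ) := mul_le_mul_of_nonneg_left h1 hδ.le
      _ = κ * u a := by field_simp
  have hUc : ∀ m, ∀ y ∈ Ω, ContDiffAt ℝ 2 (U m) y := fun m y hy =>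
    (hU m).1.contDiffAt (hΩ.mem_nhds hy)
  obtain ⟨m, hup, y₀, hy₀, hlow⟩ := ((eventually_forall_le_add (fun m => (hU m).1)
    (fun m y hy => trace_hessian_nonneg (hUc m y hy) ((hU m).2.1 y hy) hk ((hU m).2.2 y hy))
    hu.continuousOn hr hball h hη0).and (eventually_exists_sub_le
      (fun m => (hU m).1.continuousOn) hu.continuousOn hρ0 (by linarith) hball h hη0)).exists
  set φ : EuclideanSpace ℝ (Fin n) → ℝ := fun y => u y + δ * paraboloid x₀ 0 y with hφ
  have hp0 : ∀ y, 0 ≤ paraboloid x₀ 0 y := fun y => by unfold paraboloid; positivity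
  have hφ0 : ∀ y ∈ closedBall x₀ r, 0 < φ y := fun y hy =>
    add_pos_of_pos_of_nonneg (hpos y (hKΩ hy)) (mul_nonneg hδ.le (hp0 y))
  have hφc : ∀ y ∈ Ω, ContDiffAt ℝ 2 φ y := fun y hy =>
    (hu.contDiffAt (hΩ.mem_nhds hy)).add
      (contDiffAt_const.mul (contDiff_paraboloid x₀ 0).contDiffAt)
  obtain ⟨z, hzK, hzO, M, hM, heq, hle⟩ := exists_touching (O := ball x₀ r) (θ := 1 - κ) hK
    ((hU m).1.continuousOn.mono hKΩ)
    (fun y hy => (hφc y (hKΩ hy)).continuousAt.continuousWithinAt) hφ0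
    ⟨y₀, closedBall_subset_closedBall hρr hy₀, by
      have h1 : paraboloid x₀ 0 y₀ ≤ ρ ^ 2 / 2 := by
        rw [mem_closedBall, dist_eq_norm] at hy₀
        have := pow_le_pow_left₀ (norm_nonneg _) hy₀ 2
        unfold paraboloid; linarith
      have h2 : u a ≤ u y₀ := ha (closedBall_subset_closedBall hρr hy₀)
      have h3 := mul_le_mul_of_nonneg_left h1 hδ.le
      have h4 := mul_le_mul_of_nonneg_left h2 hκ0.le
      have h5 := mul_nonneg hκ0.le (mul_nonneg hδ.le (hp0 y₀))
      simp only [hφ]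
      nlinarith [mul_pos hκ0 ha0]⟩
    (fun z hz hzO => by
      have h1 : paraboloid x₀ 0 z = r ^ 2 / 2 := by
        have : dist z x₀ = r := le_antisymm hz (not_lt.1 hzO)
        rw [paraboloid, ← dist_eq_norm, this, add_zero]
      have h2 : u z ≤ u b := hb hz
      have h3 := hup z hz
      have h4 := mul_le_mul_of_nonneg_left h2 hκ0.le
      have h5 : 0 < δ * r ^ 2 := by positivity
      simp only [hφ, h1]
      nlinarith [mul_le_mul_of_nonneg_right hκ1 h5.le])
  have hzΩ := hKΩ hzK
  have hM0 : 0 < M := by linarith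
  obtain ⟨P, hP, hA⟩ := schouten_of_touching (hUc m z hzΩ) (hφc z hzΩ)
    (by filter_upwards [isOpen_ball.mem_nhds hzO] with y hy using hle y (ball_subset_closedBall hy))
    heq ((hU m).2.1 z hzΩ).le
  refine ⟨z, hzO, ?_⟩
  have h1 := (gardingCone_add_posSemidef (isHermitian_schouten (hUc m z hzΩ)) hP hkn
    ((hU m).2.2 z hzΩ)).1
  rw [← hA, eigenvalues_smul (isHermitian_schouten (hφc z hzΩ))] at h1
  exact gardingCone_of_smul (by positivity) h1

/-- A `C²` function of the class `Phi` satisfies the cone condition pointwise. -/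
theorem schouten_mem_gardingCone_of_mem_Phi {Ω : Set (EuclideanSpace ℝ (Fin n))} (hΩ : IsOpen Ω)
    {k : ℕ} (hk : 1 ≤ k) (hkn : k ≤ n) {u : EuclideanSpace ℝ (Fin n) → ℝ}
    (hu : ContDiffOn ℝ 2 u Ω) (hΦ : u ∈ Phi k Ω) {x₀ : EuclideanSpace ℝ (Fin n)} (hx₀ : x₀ ∈ Ω) :
    eigenvalues (schouten u x₀) ∈ gardingCone k := by
  obtain ⟨-, hpos, U, hU, hlim⟩ := hΦ
  have huc := hu.contDiffAt (hΩ.mem_nhds hx₀)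
  set S := {A : Matrix (Fin n) (Fin n) ℝ | A.IsHermitian ∧ eigenvalues A ∈ gardingCone k} with hS
  have hclosed : IsClosed S := isClosed_hermitian_gardingCone hkn
  have h1 : ∀ δ > 0, schouten (fun y => u y + δ * paraboloid x₀ 0 y) x₀ ∈ S := by
    intro δ hδ
    have hφc : ∀ y ∈ Ω, ContDiffAt ℝ 2 (fun y => u y + δ * paraboloid x₀ 0 y) y := fun y hy =>
      (hu.contDiffAt (hΩ.mem_nhds hy)).add
        (contDiffAt_const.mul (contDiff_paraboloid x₀ 0).contDiffAt)
    -- The cone condition holds at points tending to `x₀`, hence at `x₀`.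
    refine hclosed.mem_of_frequently_of_tendsto ?_ (continuousAt_schouten (hφc x₀ hx₀))
    rw [nhds_basis_ball.frequently_iff]
    intro ε hε
    obtain ⟨R, hR, hRΩ⟩ := Metric.isOpen_iff.1 hΩ x₀ hx₀
    set r := min ε (R / 4) with hr
    have hr0 : 0 < r := lt_min hε (by positivity)
    have hball : closedBall x₀ (2 * r) ⊆ Ω :=
      (closedBall_subset_ball (by linarith [min_le_right ε (R / 4)])).trans hRΩ
    have hK := isCompact_closedBall x₀ (2 * r)
    obtain ⟨x, hx, hxG⟩ := exists_mem_ball_of_tendsto hΩ hk hkn hU hu hpos hr0 hball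
      (tendsto_integral_abs_sub (fun m => (hU m).1.continuousOn) hu.continuousOn hK hball
        (hlim _ hK hball)) hδ
    refine ⟨x, ball_subset_ball (min_le_left _ _) hx, isHermitian_schouten (hφc x ?_), hxG⟩
    exact hball (ball_subset_closedBall (ball_subset_ball (by linarith) hx))
  have h2 : Tendsto (fun δ : ℝ => schouten u x₀ + (δ * u x₀) • (1 : Matrix (Fin n) (Fin n) ℝ))
      (𝓝[>] 0) (𝓝 (schouten u x₀)) := by
    have : Continuous fun δ : ℝ => schouten u x₀ + (δ * u x₀) • (1 : Matrix (Fin n) (Fin n) ℝ) := by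
      fun_prop
    have h3 := this.tendsto 0
    simp only [zero_mul, zero_smul, add_zero] at h3
    exact h3.mono_left nhdsWithin_le_nhds
  refine (hclosed.mem_of_tendsto h2 ?_).2
  filter_upwards [self_mem_nhdsWithin] with δ hδ
  rw [← schouten_add_paraboloid_self huc]
  exact h1 δ hδ

end

/-! ### The comparison principle -/

/-- If `M v` touches `u + ε (‖y‖² / 2 + 1)` from above at `x`, then `σ_k` of `A(M v)` strictly
exceeds `σ_k` of `τ A(u)`, where `τ > 1` is the ratio `(u + ε (‖x‖² / 2 + 1)) / u`. -/
theorem S_lt_of_touching {k : ℕ} (hk : 1 ≤ k) (hkn : k ≤ n)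
    {u v : EuclideanSpace ℝ (Fin n) → ℝ} {x : EuclideanSpace ℝ (Fin n)}
    (hu : ContDiffAt ℝ 2 u x) (hv : ContDiffAt ℝ 2 v x) (hpos : 0 < u x)
    (hG : eigenvalues (schouten u x) ∈ gardingCone k) {ε M : ℝ} (hε : 0 < ε)
    (hle : ∀ᶠ y in 𝓝 x, u y + ε * paraboloid 0 1 y ≤ M * v y)
    (heq : u x + ε * paraboloid 0 1 x = M * v x) :
    (1 + ε * paraboloid 0 1 x / u x) ^ k * S k u x < M ^ (2 * k) * S k v x := by
  have hp : 0 ≤ paraboloid 0 1 x := by unfold paraboloid; positivity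
  have hA := isHermitian_schouten hu
  obtain ⟨c, hc, hAc⟩ := schouten_add_paraboloid_zero hu hpos hε
  have hue : ContDiffAt ℝ 2 (fun y => u y + ε * paraboloid 0 1 y) x :=
    hu.add (contDiffAt_const.mul (contDiff_paraboloid 0 1).contDiffAt)
  obtain ⟨P, hP, hMA⟩ := schouten_of_touching hue hv hle heq (by positivity)
  rw [hAc] at hMA
  set τ := 1 + ε * paraboloid 0 1 x / u x with hτ
  have hτ0 : 0 ≤ τ := by positivity
  have hG1 := gardingCone_smul hτ0 hG
  have hc1 : (c • (1 : Matrix (Fin n) (Fin n) ℝ)).PosSemidef := Matrix.PosSemidef.one.smul hc.le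
  have hτA : (τ • schouten u x).IsHermitian := hA.smul (star_trivial _)
  have hG2 := (gardingCone_add_posSemidef hτA hc1 hkn
    (by rw [eigenvalues_smul hA]; exact hG1)).1
  have h1 := (gardingCone_add_posSemidef (hτA.add hc1.1) hP hkn hG2).2 k le_rfl
  rw [← hMA, eigenvalues_smul (isHermitian_schouten hv), esymm_smul, ← pow_mul,
    eigenvalues_smul_add hA] at h1
  have hcard : ((eigenvalues (schouten u x)).map fun t => τ * t).card = n := by
    rw [eigenvalues_eq_map hA]; simp
  have h2 := esymm_lt_esymm_add_const hc hk (hkn.trans hcard.ge) hG1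
  rw [esymm_smul, Multiset.map_map] at h2
  exact h2.trans_le h1

end SigmaYamabe

end

open SigmaYamabe in
theorem corollary3p4 (n k : ℕ) (hk : 1 ≤ k) (hn : 2 * k < n)
    (Ω : Set (EuclideanSpace ℝ (Fin n))) (hΩ : IsOpen Ω) (hΩb : Bornology.IsBounded Ω)
    (u v : EuclideanSpace ℝ (Fin n) → ℝ)
    (hu : SigmaYamabe.IsC2Closure Ω u) (huΦ : u ∈ SigmaYamabe.Phi k Ω)
    (hv : SigmaYamabe.IsC2Closure Ω v) (hvΦ : v ∈ SigmaYamabe.Phi k Ω)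
    (hvpos : ∀ x ∈ frontier Ω, 0 < v x)
    (hS : ∀ x ∈ Ω, v x ^ (-(n : ℤ)) * SigmaYamabe.S k v x
      ≤ u x ^ (-(n : ℤ)) * SigmaYamabe.S k u x)
    (hbdry : ∀ x ∈ frontier Ω, u x ≤ v x) :
    ∀ x ∈ Ω, u x ≤ v x := by
  by_contra! hcon
  obtain ⟨x₁, hx₁, hlt⟩ := hcon
  have hx₁K := subset_closure hx₁
  have hK : IsCompact (closure Ω) := hΩb.isCompact_closure
  have hfr : ∀ z ∈ closure Ω, z ∉ Ω → z ∈ frontier Ω := fun z hz hzΩ => by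
    rw [hΩ.frontier_eq]; exact ⟨hz, hzΩ⟩
  have hupos := huΦ.2.1
  have hv0 : ∀ y ∈ closure Ω, 0 < v y := fun y hy => by
    by_cases hyΩ : y ∈ Ω
    · exact hvΦ.2.1 y hyΩ
    · exact hvpos y (hfr y hy hyΩ)
  obtain ⟨a, haK, ha⟩ := hK.exists_isMinOn ⟨x₁, hx₁K⟩ hv.1
  have hm0 := hv0 a haK
  set m := v a with hm
  have hpc : Continuous (paraboloid (n := n) 0 1) := (contDiff_paraboloid 0 1).continuous
  obtain ⟨b, hbK, hb⟩ := hK.exists_isMaxOn ⟨x₁, hx₁K⟩ hpc.continuousOn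
  have hp0 : ∀ y : EuclideanSpace ℝ (Fin n), 0 < paraboloid 0 1 y := fun y => by
    unfold paraboloid; positivity
  set H := paraboloid 0 1 b with hH
  have hH0 : 0 < H := hp0 b
  set θ := u x₁ / v x₁ with hθ
  have hθ1 : 1 < θ := (one_lt_div (hv0 x₁ hx₁K)).2 hlt
  obtain ⟨ε, hε1, hε2, hε0⟩ : ∃ ε : ℝ, (1 + 2 * ε * H / m) ^ n < θ ∧ ε * H < m / 2 ∧ 0 < ε := by
    have h1 : Tendsto (fun ε : ℝ => (1 + 2 * ε * H / m) ^ n) (𝓝[>] 0) (𝓝 1) := by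
      have : Continuous fun ε : ℝ => (1 + 2 * ε * H / m) ^ n := by fun_prop
      simpa using (this.tendsto 0).mono_left (nhdsWithin_le_nhds (s := Set.Ioi 0))
    have h2 : Tendsto (fun ε : ℝ => ε * H) (𝓝[>] 0) (𝓝 0) := by
      have : Continuous fun ε : ℝ => ε * H := by fun_prop
      simpa using (this.tendsto 0).mono_left (nhdsWithin_le_nhds (s := Set.Ioi 0))
    exact ((h1.eventually_lt_const hθ1).and ((h2.eventually_lt_const (half_pos hm0)).and
      self_mem_nhdsWithin)).exists
  -- `q` bounds both `ε h / v` on the closure and `ε h / u` at the touching point.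
  set q := 2 * ε * H / m with hq
  have hq0 : 0 < q := by positivity
  have hqm : ε * H = q * m / 2 := by rw [hq]; field_simp
  have hqθ : 1 + q ≤ θ := (le_self_pow₀ (by linarith) (by omega)).trans hε1.le
  -- On the boundary `u + ε h ≤ θ v`, while `u + ε h > θ v` at `x₁`.
  obtain ⟨z, hzK, hzΩ, M, hM, heq, hle⟩ := exists_touching (O := Ω) (θ := θ) hK
    (f := fun y => u y + ε * paraboloid 0 1 y)
    (hu.1.add (continuous_const.mul hpc).continuousOn) hv.1 hv0
    ⟨x₁, hx₁K, by
      rw [hθ, div_mul_cancel₀ _ (hv0 x₁ hx₁K).ne']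
      linarith [mul_pos hε0 (hp0 x₁)]⟩
    (fun z hz hzΩ => by
      have h1 := hbdry z (hfr z hz hzΩ)
      have h2 := mul_le_mul_of_nonneg_left (hb hz) hε0.le
      have h3 : m ≤ v z := ha hz
      have h4 := mul_le_mul_of_nonneg_right hqθ (hv0 z hz).le
      have h5 := mul_le_mul_of_nonneg_left h3 hq0.le
      have h6 : 0 < q * m := by positivity
      change ε * paraboloid 0 1 z ≤ ε * H at h2
      linarith)
  have hM1 : 1 < M := hθ1.trans hM
  have hM0 : 0 < M := by linarith
  have huz := hupos z hzΩ
  have hvz := hv0 z hzK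
  set τ := 1 + ε * paraboloid 0 1 z / u z with hτ
  have hpz := hp0 z
  have hτ1 : 1 ≤ τ := by
    have : 0 ≤ ε * paraboloid 0 1 z / u z := by positivity
    linarith
  have hτq : τ ≤ 1 + q := by
    have h2 : ε * paraboloid 0 1 z ≤ ε * H := mul_le_mul_of_nonneg_left (hb hzK) hε0.le
    have h3 : m ≤ v z := ha hzK
    have h4 : v z ≤ M * v z := le_mul_of_one_le_left hvz.le hM1.le
    have h5 : m / 2 ≤ u z := by linarith
    have h6 : ε * paraboloid 0 1 z / u z ≤ q := by
      rw [div_le_iff₀ huz]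
      linarith [mul_le_mul_of_nonneg_left h5 hq0.le]
    linarith
  have hτn : τ ^ n < M :=
    ((pow_le_pow_left₀ (by linarith) hτq n).trans_lt hε1).trans hM
  have hG := schouten_mem_gardingCone_of_mem_Phi hΩ hk (by omega) hu.2.1 huΦ hzΩ
  have hstrict := S_lt_of_touching hk (by omega) (hu.2.1.contDiffAt (hΩ.mem_nhds hzΩ))
    (hv.2.1.contDiffAt (hΩ.mem_nhds hzΩ)) huz hG hε0
    (by filter_upwards [hΩ.mem_nhds hzΩ] with y hy using hle y (subset_closure hy)) heq
  have hSu : 0 ≤ S k u z := hG k hk le_rfl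
  -- The scaling defect `M ^ (n - 2 * k)`, with `n > 2 * k`, beats the loss `τ ^ n`.
  have hvM : M * v z = u z * τ := by
    rw [← heq, hτ]; field_simp
  have hSz : S k v z * u z ^ n ≤ S k u z * v z ^ n := by
    have := hS z hzΩ
    rw [zpow_neg, zpow_neg, zpow_natCast, zpow_natCast, inv_mul_eq_div, inv_mul_eq_div,
      div_le_div_iff₀ (by positivity) (by positivity)] at this
    exact this
  have h1 : S k v z * M ^ n ≤ S k u z * τ ^ n := by
    have h2 := mul_le_mul_of_nonneg_right hSz (pow_nonneg hM0.le n)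
    have h3 : S k u z * v z ^ n * M ^ n = S k u z * τ ^ n * u z ^ n := by
      rw [mul_assoc, ← mul_pow, mul_comm (v z), hvM, mul_pow]; ring
    rw [h3] at h2
    refine le_of_mul_le_mul_right ?_ (pow_pos huz n)
    linarith
  have h2 : τ ^ n ≤ M ^ (n - 2 * k) :=
    hτn.le.trans (le_self_pow₀ hM1.le (by omega))
  have h3 : S k u z * τ ^ n < S k v z * M ^ n := calc
    S k u z * τ ^ n ≤ (τ ^ k * S k u z) * M ^ (n - 2 * k) := by
      have h4 : S k u z ≤ τ ^ k * S k u z := le_mul_of_one_le_left hSu (one_le_pow₀ hτ1)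
      exact mul_le_mul h4 h2 (by positivity) (hSu.trans h4)
    _ < (M ^ (2 * k) * S k v z) * M ^ (n - 2 * k) :=
      mul_lt_mul_of_pos_right hstrict (by positivity)
    _ = S k v z * M ^ n := by
      rw [mul_comm (M ^ (2 * k)), mul_assoc, ← pow_add]
      congr 2; omega
  exact absurd h1 (not_le.2 h3)
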